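/- **Setting.** For real parameters $a_i,b_i$ and $A_i,B_i>0$ let $$\Theta(v)=\frac{\prod_{i=1}^{m}\Gamma(b_i+B_iv)\prod_{i=1}^{n}\Gamma(1-a_i-A_iv)}{\prod_{i=n+1}^{p}\Gamma(a_i+A_iv)\prod_{i=m+1}^{q}\Gamma(1-b_i-B_iv)},\qquad H^{m,n}_{p,q}(x)=\frac1{2\pi j}\int_{\mathcal L}\Theta(v)\,x^{-v}\,dv\quad(x>0),$$ where $\mathcal L$ is a vertical line which has the poles of the $\Gamma(b_i+B_iv)$, $i\le m$, on its left and those of the $\Gamma(1-a_i-A_iv)$, $i\le n$, on its right, and along which $\Theta$ is absolutely integrable. Let the ideal SNR $\gamma_{id}$ be a positive random variable with the density $$f(\gamma)=\sum_{\ell=1}^{L}\psi_\ell\,H^{m,n}_{p,q}\!\left(\phi_\ell\gamma\,\middle|\,\begin{matrix}(a_i^{(\ell)},A_i^{(\ell)})_{i=1:p}\\(b_i^{(\ell)},B_i^{(\ell)})_{i=1:q}\end{matrix}\right),\qquad \gamma>0,$$ where $\psi_\ell,\phi_\ell>0$, and let $\gamma_\varkappa=\dfrac{\omega}{\varrho+\tau/\gamma_{id}}$,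 with $\omega,\varrho,\tau>0$, be the SINR of the impaired link. Put $\mathcal A_i^{(\ell)}=a_i^{(\ell)}+A_i^{(\ell)}$, $\mathcal B_i^{(\ell)}=b_i^{(\ell)}+B_i^{(\ell)}$, and for $x,y>0$ let $$\mathbf H_\ell(x,y)=\frac1{(2\pi j)^2}\int_{\mathcal L_v^{(\ell)}}\!\int_{\mathcal L_s^{(\ell)}}\Gamma(-v-s)\,\frac{\Gamma(v)\prod_{i=1}^{m}\Gamma(\mathcal B_i^{(\ell)}+B_i^{(\ell)}v)\prod_{i=1}^{n}\Gamma(1-\mathcal A_i^{(\ell)}-A_i^{(\ell)}v)}{\prod_{i=n+1}^{p}\Gamma(\mathcal A_i^{(\ell)}+A_i^{(\ell)}v)\prod_{i=m+1}^{q}\Gamma(1-\mathcal B_i^{(\ell)}-B_i^{(\ell)}v)}\,\frac{\Gamma(1+s)}{\Gamma(1-s)}\,x^{-v}y^{-s}\,ds\,dv ,$$ that is, the bivariate Fox H-function $$H^{0,1:m+1,n:1,0}_{1,0:p,q+1:0,2}\!\left(x,y\,\middle|\,\begin{matrix}(1;1,1)\\-\end{matrix}\,\middle|\,\begin{matrix}(\mathcal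 A_i^{(\ell)},A_i^{(\ell)})_{i=1:p}\\(0,1),(\mathcal B_i^{(\ell)},B_i^{(\ell)})_{i=1:q}\end{matrix}\,\middle|\,\begin{matrix}-\\(1,1);(0,1)\end{matrix}\right),$$ where $\mathcal L_v^{(\ell)},\mathcal L_s^{(\ell)}$ are any vertical lines $\operatorname{Re}v=c_\ell$, $\operatorname{Re}s=d_\ell$ on which the arguments of all the Gamma functions in the numerator have positive real part. **SEP.** Let $$\mathcal D(a,b,c,\gamma)=\frac a\pi\int_0^{b\pi}e^{-c\gamma/\sin^2t}\,dt,\qquad \mathcal E(a,b,c,d,\gamma)=\frac a\pi\int_0^{b\pi}e^{-c\gamma/(1+d\cos t)}\,dt .$$ The symbol error probability $\mathcal H(\gamma)$ is * $M$-PSK ($M\ge2$): $\mathcal D(1,\frac{M-1}M,\sin^2\frac\pi M,\gamma)$; * $M$-QAM ($M\ge 2$): $\mathcal D(\frac{4(\sqrt M-1)}{\sqrt M},\frac12,\frac3{2(M-1)},\gamma)-\mathcal D(4(\frac{\sqrt M-1}{\sqrt M})^2,\frac14,\frac3{2(M-1)},\gamma)$; * $M$-DPSK ($M\ge2$): $\mathcal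 E(1,\frac{M-1}M,\sin^2\frac\pi M,\cos\frac\pi M,\gamma)$; * GC-DQPSK: $\mathcal E(\frac12,1,1,-\frac1{\sqrt2},\gamma)$. Let $\mathcal H_N(\gamma)$ be its approximation by the composite trapezoidal rule with $N\ge1$ subintervals. For $M$-QAM, $N$ is even and the second integral gets $N/2$ subintervals. The integrand of $\mathcal D$ is read as its limit $0$ at $t=0$. Put * $M$-PSK, $M$-DPSK: $\theta_0=\theta_N=\frac{M-1}{2NM}$ and $\theta_n=\frac{M-1}{NM}$ for $0<n<N$; $\delta_n=\frac{\sin^2(\pi/M)}{\sin^2(n(M-1)\pi/(NM))}$ for $M$-PSK, $\delta_n=\frac{\sin^2(\pi/M)}{1+\cos(\pi/M)\cos(n(M-1)\pi/(NM))}$ for $M$-DPSK; * GC-DQPSK: $\theta_0=\theta_N=\frac1{4N}$ and $\theta_n=\frac1{2N}$ for $0<n<N$; $\delta_n=\frac1{1-\frac1{\sqrt2}\cos(n\pi/N)}$; * $M$-QAM: $\theta_0=\frac{\sqrt M-1}{NM}$; $\theta_n=\frac{2(\sqrt M-1)}{NM}$ for $0<n<\frac N2$; $\theta_{N/2}=\frac{M-1}{NM}$;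 $\theta_n=\frac{2(\sqrt M-1)}{N\sqrt M}$ for $\frac N2<n<N$; $\theta_N=\frac{\sqrt M-1}{N\sqrt M}$; $\delta_n=\frac3{2(M-1)\sin^2(n\pi/(2N))}$; with $\delta_0=\infty$ for $M$-PSK and $M$-QAM. **Proposition.** For each of the four modulation schemes $\gamma_\varkappa$ has a density $f_{\gamma_\varkappa}$, the double integrals $\mathbf H_\ell(x,y)$ converge absolutely for all $x,y>0$, and the ASEP with the SEP replaced by its trapezoidal approximation is $$\int_0^\infty f_{\gamma_\varkappa}(\gamma)\,\mathcal H_N(\gamma)\,d\gamma=\sum_{n=0}^{N}\theta_n\left[1-\sum_{\ell=1}^{L}\frac{\psi_\ell}{\phi_\ell}\,\mathbf H_\ell\!\left(\frac{\phi_\ell\tau}{\varrho},\frac{\delta_n\omega}{\varrho}\right)\right],$$ where for $\delta_n=\infty$ the bracket denotes its limit as $\delta_n\to\infty$, which exists and equals $0$. -/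

import Mathlib

open MeasureTheory Set Filter Topology
open scoped ENNReal

noncomputable section

/-- Parameters `(a_i, A_i)_{i = 1..p}`, `(b_i, B_i)_{i = 1..q}` of a univariate Fox H-function
`H^{m,n}_{p,q}`. Indices are shifted to start at `0`. -/
structure FoxParams (m n p q : ℕ) where
  a : Fin p → ℝ
  A : Fin p → ℝ
  b : Fin q → ℝ
  B : Fin q → ℝ

/-- The Mellin-Barnes kernel
`∏_{i ≤ m} Γ(b_i + B_i v) ∏_{i ≤ n} Γ(1 - a_i - A_i v) /
  (∏_{i > n} Γ(a_i + A_i v) ∏_{i > m} Γ(1 - b_i - B_i v))`.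
At a pole of a Gamma factor of the denominator, Mathlib's conventions (`Γ = 0` there and
`1 / 0 = 0`) give the value `0` of the entire function `1 / Γ`. -/
def FoxParams.kernel {m n p q : ℕ} (F : FoxParams m n p q) (v : ℂ) : ℂ :=
  ((∏ i ∈ Finset.univ.filter (fun i : Fin q => i.val < m), Complex.Gamma (F.b i + F.B i * v)) *
      ∏ i ∈ Finset.univ.filter (fun i : Fin p => i.val < n), Complex.Gamma (1 - F.a i - F.A i * v)) /
    ((∏ i ∈ Finset.univ.filter (fun i : Fin p => n ≤ i.val), Complex.Gamma (F.a i + F.A i * v)) *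
      ∏ i ∈ Finset.univ.filter (fun i : Fin q => m ≤ i.val), Complex.Gamma (1 - F.b i - F.B i * v))

/-- The vertical line `Re v = c` separates the poles of the `Γ(b_i + B_i v)`, `i ≤ m`
(on its left) from those of the `Γ(1 - a_i - A_i v)`, `i ≤ n` (on its right); here
the `A_i`, `B_i` are positive. -/
def FoxParams.Separates {m n p q : ℕ} (F : FoxParams m n p q) (c : ℝ) : Prop :=
  (∀ i : Fin q, (i : ℕ) < m → 0 < F.b i + F.B i * c) ∧
    ∀ i : Fin p, (i : ℕ) < n → 0 < 1 - F.a i - F.A i * c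

/-- The point `c + i y` of the vertical line of abscissa `c`. -/
def linePt (c y : ℝ) : ℂ := (c : ℂ) + (y : ℂ) * Complex.I

/-- Absolute convergence, for positive arguments, of the Mellin-Barnes integral along the line
`Re v = c` (the factor `x ^ (-v)` has constant modulus there). -/
def FoxParams.Converges {m n p q : ℕ} (F : FoxParams m n p q) (c : ℝ) : Prop :=
  Integrable (fun y : ℝ => F.kernel (linePt c y))

/-- The univariate Fox H-function at `x > 0`,
`(1 / 2πi) ∫_{Re v = c} kernel(v) x ^ (-v) dv`, with `v = c + i y`, `dv = i dy`. -/
def foxH {m n p q : ℕ} (F : FoxParams m n p q) (c x : ℝ) : ℂ :=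
  (1 / (2 * (Real.pi : ℂ))) * ∫ y : ℝ, F.kernel (linePt c y) * (x : ℂ) ^ (-linePt c y)

/-- Parameters `(a_i; α_i, A_i)_{i = 1..p}`, `(b_i; β_i, B_i)_{i = 1..q}` of the factor of a
bivariate Fox H-function which couples the two variables; its upper orders are `0, n`. -/
structure FoxCross (n p q : ℕ) where
  a : Fin p → ℝ
  α : Fin p → ℝ
  A : Fin p → ℝ
  b : Fin q → ℝ
  β : Fin q → ℝ
  B : Fin q → ℝ

/-- The coupling kernel `∏_{i ≤ n} Γ(1 - a_i - α_i v - A_i s) /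
  (∏_{i > n} Γ(a_i + α_i v + A_i s) ∏_{i ≤ q} Γ(1 - b_i - β_i v - B_i s))`. -/
def FoxCross.kernel {n p q : ℕ} (C : FoxCross n p q) (v s : ℂ) : ℂ :=
  (∏ i ∈ Finset.univ.filter (fun i : Fin p => i.val < n), Complex.Gamma (1 - C.a i - C.α i * v - C.A i * s)) /
    ((∏ i ∈ Finset.univ.filter (fun i : Fin p => n ≤ i.val), Complex.Gamma (C.a i + C.α i * v + C.A i * s)) *
      ∏ i : Fin q, Complex.Gamma (1 - C.b i - C.β i * v - C.B i * s))

/-- The pair of vertical lines `Re v = c`, `Re s = d` separates the poles of the numerator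
Gamma factors of a bivariate Fox H-function. -/
def foxH2Separates {n₁ p₁ q₁ m₂ n₂ p₂ q₂ m₃ n₃ p₃ q₃ : ℕ} (C : FoxCross n₁ p₁ q₁)
    (F : FoxParams m₂ n₂ p₂ q₂) (G : FoxParams m₃ n₃ p₃ q₃) (c d : ℝ) : Prop :=
  F.Separates c ∧ G.Separates d ∧
    ∀ i : Fin p₁, (i : ℕ) < n₁ → 0 < 1 - C.a i - C.α i * c - C.A i * d

/-- The integrand of the bivariate Fox H-function with arguments `x, y` at `v = c + i w.1`,
`s = d + i w.2`. -/
def foxH2Integrand {n₁ p₁ q₁ m₂ n₂ p₂ q₂ m₃ n₃ p₃ q₃ : ℕ} (C : FoxCross n₁ p₁ q₁)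
    (F : FoxParams m₂ n₂ p₂ q₂) (G : FoxParams m₃ n₃ p₃ q₃) (c d x y : ℝ) (w : ℝ × ℝ) : ℂ :=
  C.kernel (linePt c w.1) (linePt d w.2) * F.kernel (linePt c w.1) * G.kernel (linePt d w.2) *
    (x : ℂ) ^ (-linePt c w.1) * (y : ℂ) ^ (-linePt d w.2)

/-- The bivariate Fox H-function `H^{0,n₁:m₂,n₂:m₃,n₃}_{p₁,q₁:p₂,q₂:p₃,q₃}` at `x, y > 0`:
the double Mellin-Barnes integral `(1 / 2πi)² ∫∫ … x ^ (-v) y ^ (-s) dv ds` along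
`Re v = c`, `Re s = d`. -/
def foxH2 {n₁ p₁ q₁ m₂ n₂ p₂ q₂ m₃ n₃ p₃ q₃ : ℕ} (C : FoxCross n₁ p₁ q₁)
    (F : FoxParams m₂ n₂ p₂ q₂) (G : FoxParams m₃ n₃ p₃ q₃) (c d x y : ℝ) : ℂ :=
  (1 / (2 * (Real.pi : ℂ))) ^ 2 * ∫ w : ℝ × ℝ, foxH2Integrand C F G c d x y w

/-- From `(a_i, A_i)`, `(b_i, B_i)` the parameters `Ψ = (a_i + A_i, A_i)_{i = 1..p}` and
`(0, 1), Υ` with `Υ = (b_i + B_i, B_i)_{i = 1..q}`, of orders `m + 1, n, p, q + 1`. -/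
def FoxParams.shift {m n p q : ℕ} (F : FoxParams m n p q) : FoxParams (m + 1) n p (q + 1) where
  a := fun i => F.a i + F.A i
  A := F.A
  b := Fin.cons 0 fun i => F.b i + F.B i
  B := Fin.cons 1 F.B

/-- The coupling parameters `(1; 1, 1)`, of orders `0, 1, 1, 0`. -/
def asepCross : FoxCross 1 1 0 where
  a := ![1]
  α := ![1]
  A := ![1]
  b := ![]
  β := ![]
  B := ![]

/-- The parameters `-` and `(1, 1); (0, 1)`, of orders `1, 0, 0, 2`. -/
def asepSecond : FoxParams 1 0 0 2 where
  a := ![]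
  A := ![]
  b := ![1, 0]
  B := ![1, 1]

/-- `1 - ∑_ℓ (ψ_ℓ / φ_ℓ) H^{0,1:m+1,n:1,0}_{1,0:p,q+1:0,2}(φ_ℓ τ / ϱ, δ ω / ϱ)`. -/
def asepBracket {L m n p q : ℕ} (ψ φ : Fin L → ℝ) (F : Fin L → FoxParams m n p q)
    (c d : Fin L → ℝ) (ω ϱ τ δ : ℝ) : ℂ :=
  1 - ∑ l : Fin L, ((ψ l / φ l : ℝ) : ℂ) *
    foxH2 asepCross (F l).shift asepSecond (c l) (d l) (φ l * τ / ϱ) (δ * ω / ϱ)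

/-- `asepBracket` for a rate `δ ∈ [0, ∞]`; at `δ = ∞` it is the limit `0` as `δ → ∞`. -/
def asepBracketExt {L m n p q : ℕ} (ψ φ : Fin L → ℝ) (F : Fin L → FoxParams m n p q)
    (c d : Fin L → ℝ) (ω ϱ τ : ℝ) (δ : ℝ≥0∞) : ℂ :=
  if δ = ⊤ then 0 else asepBracket ψ φ F c d ω ϱ τ δ.toReal

/-- The signal-to-interference-plus-noise ratio `ω / (ϱ + τ / γ_id)` of the impaired link. -/
def sinr (ω ϱ τ γid : ℝ) : ℝ := ω / (ϱ + τ / γid)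

/-- The four modulation schemes, with their constellation sizes. -/
inductive Modulation where
  | psk (M : ℕ)
  | qam (M : ℕ)
  | dpsk (M : ℕ)
  | gcdqpsk

/-- Admissible constellation sizes and numbers `N` of subintervals (even for `M`-QAM). -/
def Modulation.Admissible : Modulation → ℕ → Prop
  | .psk M, N => 2 ≤ M ∧ 1 ≤ N
  | .qam M, N => 2 ≤ M ∧ 1 ≤ N ∧ Even N
  | .dpsk M, N => 2 ≤ M ∧ 1 ≤ N
  | .gcdqpsk, N => 1 ≤ N

/-- The composite trapezoidal rule with `N` subintervals for `∫ t in 0..b, g t`. -/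
def trapezoid (g : ℝ → ℝ) (b : ℝ) (N : ℕ) : ℝ :=
  b / N / 2 * (g 0 + g b + 2 * ∑ k ∈ Finset.Ico 1 N, g (k * (b / N)))

/-- Trapezoidal rule for `(a / π) ∫_0^{bπ} exp(-c γ / sin² t) dt`; where `sin t = 0` the
integrand has the value `0`, its limit for `c γ > 0`. -/
def trapD (a b c : ℝ) (N : ℕ) (γ : ℝ) : ℝ :=
  a / Real.pi * trapezoid
    (fun t => if Real.sin t = 0 then 0 else Real.exp (-(c * γ / Real.sin t ^ 2))) (b * Real.pi) N

/-- Trapezoidal rule for `(a / π) ∫_0^{bπ} exp(-c γ / (1 + d cos t)) dt`. -/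
def trapE (a b c d : ℝ) (N : ℕ) (γ : ℝ) : ℝ :=
  a / Real.pi * trapezoid
    (fun t => Real.exp (-(c * γ / (1 + d * Real.cos t)))) (b * Real.pi) N

/-- The trapezoidal approximation of the symbol error probability at SNR `γ`. For `M`-QAM, whose
error probability is a difference of integrals over `[0, π/2]` and `[0, π/4]`, both integrals
are discretized with the step `π / (2N)`. -/
def sepTrapezoid : Modulation → ℕ → ℝ → ℝ
  | .psk M, N, γ => trapD 1 ((M - 1) / M) (Real.sin (Real.pi / M) ^ 2) N γ
  | .qam M, N, γ =>
      trapD (4 * (√M - 1) / √M) (1 / 2) (3 / (2 * (M - 1))) N γ -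
        trapD (4 * ((√M - 1) / √M) ^ 2) (1 / 4) (3 / (2 * (M - 1))) (N / 2) γ
  | .dpsk M, N, γ =>
      trapE 1 ((M - 1) / M) (Real.sin (Real.pi / M) ^ 2) (Real.cos (Real.pi / M)) N γ
  | .gcdqpsk, N, γ => trapE (1 / 2) 1 1 (-(1 / √2)) N γ

/-- The weights `θ_n`, `0 ≤ n ≤ N`. -/
def sepTheta : Modulation → ℕ → ℕ → ℝ
  | .psk M, N, n => if n = 0 ∨ n = N then (M - 1) / (2 * N * M) else (M - 1) / (N * M)
  | .qam M, N, n =>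
      if n = 0 then (√M - 1) / (N * M)
      else if n < N / 2 then 2 * ((√M - 1) / (N * M))
      else if n = N / 2 then (M - 1) / (N * M)
      else if n < N then 2 * ((√M - 1) / (N * √M))
      else (√M - 1) / (N * √M)
  | .dpsk M, N, n => if n = 0 ∨ n = N then (M - 1) / (2 * N * M) else (M - 1) / (N * M)
  | .gcdqpsk, N, n => if n = 0 ∨ n = N then 1 / (4 * N) else 1 / (2 * N)

/-- The rates `δ_n`, `0 ≤ n ≤ N`, in `[0, ∞]`. For `M`-PSK and `M`-QAM, `δ_0 = ∞` (a positive
number divided by `sin² 0 = 0`). -/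
def sepDelta : Modulation → ℕ → ℕ → ℝ≥0∞
  | .psk M, N, n =>
      ENNReal.ofReal (Real.sin (Real.pi / M) ^ 2) /
        ENNReal.ofReal (Real.sin (n * (M - 1) * Real.pi / (N * M)) ^ 2)
  | .qam M, N, n =>
      ENNReal.ofReal 3 /
        ENNReal.ofReal (2 * (M - 1) * Real.sin (n * Real.pi / (2 * N)) ^ 2)
  | .dpsk M, N, n =>
      ENNReal.ofReal (Real.sin (Real.pi / M) ^ 2 /
        (1 + Real.cos (Real.pi / M) * Real.cos (n * (M - 1) * Real.pi / (N * M))))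
  | .gcdqpsk, N, n =>
      ENNReal.ofReal (1 / (1 - 1 / √2 * Real.cos (n * Real.pi / N)))

end

/-! The trapezoidal sum is a finite combination of exponentials `exp (-δ γ)`, so everything reduces
to the Laplace transform of the SINR. With κ = δω/ϱ and r = τ/ϱ one has δ · `sinr` x = κx/(x + r),
so this transform is 1 - ∫ f(x) (1 - exp(-κx/(x + r))) dx, the integrand containing `satExp`.

Mellin inversion writes 1 - exp(-t) as a contour integral of -Γ(s) t^(-s) on a line -1 < Re s < 0.
Multiplying by x^(-(v+1)) and integrating in x gives the Beta integral Γ(-v-s)Γ(v)/Γ(-s) r^(-v).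
Hence the Mellin transform of `satExp` is a single contour integral (`integral_cpow_mul_satExp`),
and pairing it with the Fox kernels of f yields the bivariate H-functions.

The obstacle is the contour. The density is given on Re v = c₀, whereas the pairing needs the line
Re v = c + 1 with 0 < c < 1, and absolute integrability of the kernel is known on the first line
only. Gamma ratios show that the kernel on another separating line is worse by at most a polynomial
factor (`exists_kernel_bound`). To absorb it, f(x) is replaced by its average over f(x exp(-εZ)), Z
standard normal (ε is `s` in the code). This multiplies the kernel by exp(ε²v²/2), whose Gaussian
decay permits both the contour shift and Fubini (`integral_foxH_gaussian`,
`integral_smoothing_mul_satExp`).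

Finally ε → 0. On the density side the smoothing converges weakly (`tendsto_integral_lognormal`). On
the contour side dominated convergence applies, because the double integral converges absolutely
without smoothing: Γ(v) already beats every polynomial (`integrable_foxH2Integrand_asep`). Comparing
the limits gives `integral_foxH_sum_mul_satExp`. -/

/-! ### The Gamma function on vertical lines -/

@[simp] lemma linePt_re (c y : ℝ) : (linePt c y).re = c := by simp [linePt]

@[simp] lemma linePt_im (c y : ℝ) : (linePt c y).im = y := by simp [linePt]

lemma abs_im_le_norm_linePt (c y : ℝ) : |y| ≤ ‖linePt c y‖ := by
  simpa using Complex.abs_im_le_norm (linePt c y)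

lemma le_norm_linePt (c y : ℝ) : c ≤ ‖linePt c y‖ := by
  simpa using (le_abs_self _).trans (Complex.abs_re_le_norm (linePt c y))

lemma norm_linePt_le (c y : ℝ) : ‖linePt c y‖ ≤ |c| + |y| := by
  simpa using Complex.norm_le_abs_re_add_abs_im (linePt c y)

lemma linePt_add_ofReal (c h y : ℝ) : linePt c y + h = linePt (c + h) y := by
  simp only [linePt]; push_cast; ring

lemma continuous_linePt (c : ℝ) : Continuous (linePt c) := by
  unfold linePt; fun_prop

/-- Triangle inequality: the modulus of the Beta integrand is the real Beta integrand at the real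
parts. Combined with Γ(z)Γ(h) = Γ(z+h)B(z,h), it compares |Γ| at two abscissae. -/
lemma norm_betaIntegral_le {u v : ℂ} (hu : 0 < u.re) (hv : 0 < v.re) :
    ‖Complex.betaIntegral u v‖ ≤ Real.Gamma u.re * Real.Gamma v.re / Real.Gamma (u.re + v.re) := by
  have h1 : ‖Complex.betaIntegral u v‖ ≤
      ∫ x in (0:ℝ)..1, x ^ (u.re - 1) * (1 - x) ^ (v.re - 1) := by
    unfold Complex.betaIntegral
    have : ∀ x ∈ Ioo (0:ℝ) 1, ‖(x : ℂ) ^ (u - 1) * (1 - (x : ℂ)) ^ (v - 1)‖ =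
        x ^ (u.re - 1) * (1 - x) ^ (v.re - 1) := by
      intro x hx
      have h2 : (1 - (x : ℂ)) = ((1 - x : ℝ) : ℂ) := by push_cast; ring
      rw [norm_mul, h2, Complex.norm_cpow_eq_rpow_re_of_pos hx.1,
        Complex.norm_cpow_eq_rpow_re_of_pos (by linarith [hx.2])]
      simp
    refine (intervalIntegral.norm_integral_le_integral_norm zero_le_one).trans (le_of_eq ?_)
    rw [intervalIntegral.integral_of_le zero_le_one, intervalIntegral.integral_of_le zero_le_one,
      integral_Ioc_eq_integral_Ioo, integral_Ioc_eq_integral_Ioo]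
    exact setIntegral_congr_fun measurableSet_Ioo this
  refine h1.trans (le_of_eq ?_)
  have h2 : ((∫ x in (0:ℝ)..1, x ^ (u.re - 1) * (1 - x) ^ (v.re - 1) : ℝ) : ℂ) =
      Complex.betaIntegral u.re v.re := by
    unfold Complex.betaIntegral
    rw [← intervalIntegral.integral_ofReal]
    rw [intervalIntegral.integral_of_le zero_le_one, intervalIntegral.integral_of_le zero_le_one,
      integral_Ioc_eq_integral_Ioo, integral_Ioc_eq_integral_Ioo]
    refine setIntegral_congr_fun measurableSet_Ioo fun x hx => ?_
    have h2 : (1 - (x : ℂ)) = ((1 - x : ℝ) : ℂ) := by push_cast; ring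
    simp only [h2]
    rw [Complex.ofReal_mul, Complex.ofReal_cpow hx.1.le, Complex.ofReal_cpow (by linarith [hx.2])]
    push_cast; rfl
  have h3 := Complex.betaIntegral_eq_Gamma_mul_div (u.re : ℂ) (v.re : ℂ) (by simpa) (by simpa)
  rw [← h2] at h3
  apply Complex.ofReal_injective
  rw [h3]
  simp only [← Complex.ofReal_add, Complex.Gamma_ofReal]
  push_cast; rfl

/-- On a horizontal line in the right half plane `‖Γ(z)‖ / Γ(Re z)` is nondecreasing. -/
lemma norm_Gamma_mul_le {x x' : ℝ} (hx : 0 < x) (hxx : x ≤ x') (y : ℝ) :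
    ‖Complex.Gamma (linePt x y)‖ * Real.Gamma x' ≤ ‖Complex.Gamma (linePt x' y)‖ * Real.Gamma x := by
  rcases hxx.eq_or_lt with rfl | hlt
  · rfl
  have hh : 0 < x' - x := by linarith
  have h1 := Complex.Gamma_mul_Gamma_eq_betaIntegral (s := linePt x y) (t := ((x' - x : ℝ) : ℂ))
    (by simpa) (by simpa)
  have h2 := norm_betaIntegral_le (u := linePt x y) (v := ((x' - x : ℝ) : ℂ)) (by simpa) (by simpa)
  rw [linePt_add_ofReal, Complex.Gamma_ofReal, add_sub_cancel] at h1
  simp only [linePt_re, Complex.ofReal_re, add_sub_cancel] at h2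
  have h3 := congrArg norm h1
  have hG := Real.Gamma_pos_of_pos hh
  have hG' := Real.Gamma_pos_of_pos (hx.trans hlt)
  rw [norm_mul, norm_mul, Complex.norm_real, Real.norm_of_nonneg hG.le] at h3
  rw [le_div_iff₀ hG'] at h2
  have h4 : ‖Complex.Gamma (linePt x y)‖ * Real.Gamma x' * Real.Gamma (x' - x) ≤
      ‖Complex.Gamma (linePt x' y)‖ * Real.Gamma x * Real.Gamma (x' - x) := by
    calc _ = ‖Complex.Gamma (linePt x y)‖ * Real.Gamma (x' - x) * Real.Gamma x' := by ring
      _ = ‖Complex.Gamma (linePt x' y)‖ *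
          (‖Complex.betaIntegral (linePt x y) ((x' - x : ℝ) : ℂ)‖ * Real.Gamma x') := by
            rw [h3]; ring
      _ ≤ ‖Complex.Gamma (linePt x' y)‖ * (Real.Gamma x * Real.Gamma (x' - x)) := by gcongr
      _ = _ := by ring
  exact le_of_mul_le_mul_right h4 hG

lemma norm_Gamma_linePt_le {x : ℝ} (hx : 0 < x) (y : ℝ) :
    ‖Complex.Gamma (linePt x y)‖ ≤ Real.Gamma x := by
  rw [Complex.Gamma_eq_integral (by simpa), Complex.GammaIntegral, Real.Gamma_eq_integral hx]
  refine (norm_integral_le_integral_norm _).trans (le_of_eq ?_)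
  refine setIntegral_congr_fun measurableSet_Ioi fun t ht => ?_
  simp only [norm_mul, Complex.norm_real, Real.norm_of_nonneg (Real.exp_pos _).le]
  rw [Complex.norm_cpow_eq_rpow_re_of_pos ht]
  simp

/-- The Gamma function decays faster than any polynomial on vertical lines. -/
lemma exists_norm_Gamma_decay (k : ℕ) : ∀ {x : ℝ}, 0 < x →
    ∃ C, 0 ≤ C ∧ ∀ y, ‖Complex.Gamma (linePt x y)‖ * (1 + |y|) ^ k ≤ C := by
  induction k with
  | zero =>
    intro x hx
    exact ⟨Real.Gamma x, (Real.Gamma_pos_of_pos hx).le, fun y => by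
      simpa using norm_Gamma_linePt_le hx y⟩
  | succ k ih =>
    intro x hx
    -- Each use of Γ(z) = Γ(z+1)/z gains one factor 1 + |y|, at the price of moving to abscissa x +
    -- 1.
    obtain ⟨C, hC0, hC⟩ := ih (x := x + 1) (by linarith)
    refine ⟨(x⁻¹ + 1) * C, by positivity, fun y => ?_⟩
    have h1 : 1 + |y| ≤ (x⁻¹ + 1) * ‖linePt x y‖ := by
      have h2 := le_norm_linePt x y
      have h3 := abs_im_le_norm_linePt x y
      have h4 : x⁻¹ * x ≤ x⁻¹ * ‖linePt x y‖ := by gcongr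
      rw [inv_mul_cancel₀ hx.ne'] at h4
      linarith
    have h5 := Complex.Gamma_add_one (linePt x y) (by
      intro h; have := congrArg Complex.re h; simp at this; linarith)
    have h6 : linePt x y + 1 = linePt (x + 1) y := by simpa using linePt_add_ofReal x 1 y
    rw [h6] at h5
    calc ‖Complex.Gamma (linePt x y)‖ * (1 + |y|) ^ (k + 1)
        = ‖Complex.Gamma (linePt x y)‖ * (1 + |y|) ^ k * (1 + |y|) := by ring
      _ ≤ ‖Complex.Gamma (linePt x y)‖ * (1 + |y|) ^ k * ((x⁻¹ + 1) * ‖linePt x y‖) := by gcongr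
      _ = (x⁻¹ + 1) * (‖Complex.Gamma (linePt (x + 1) y)‖ * (1 + |y|) ^ k) := by
        rw [h5, norm_mul]; ring
      _ ≤ _ := by gcongr; exact hC y

lemma continuous_Gamma_linePt {x : ℝ} (hx : 0 < x) :
    Continuous fun y => Complex.Gamma (linePt x y) := by
  refine continuous_iff_continuousAt.2 fun y => ?_
  refine ContinuousAt.comp (Complex.differentiableAt_Gamma _ fun m h => ?_).continuousAt
    (continuous_linePt x).continuousAt
  have := congrArg Complex.re h
  simp at this
  linarith [m.cast_nonneg (α := ℝ)]

lemma integrable_of_norm_mul_sq_le {E : Type*} [NormedAddCommGroup E] {f : ℝ → E} {C : ℝ}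
    (hf : AEStronglyMeasurable f)
    (h : ∀ y, ‖f y‖ * (1 + |y|) ^ 2 ≤ C) : Integrable f := by
  refine ((integrable_inv_one_add_sq).const_mul C).mono' hf (ae_of_all _ fun y => ?_)
  have h1 : 0 < 1 + y ^ 2 := by positivity
  rw [← div_eq_mul_inv, le_div_iff₀ h1]
  refine le_trans ?_ (h y)
  gcongr
  nlinarith [abs_nonneg y, sq_abs y]

lemma integrable_Gamma_linePt {x : ℝ} (hx : 0 < x) :
    Integrable fun y => Complex.Gamma (linePt x y) := by
  obtain ⟨C, _, hC⟩ := exists_norm_Gamma_decay 2 hx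
  exact integrable_of_norm_mul_sq_le (continuous_Gamma_linePt hx).aestronglyMeasurable hC

lemma Gamma_linePt_ne_zero {x y : ℝ} (hy : y ≠ 0) : Complex.Gamma (linePt x y) ≠ 0 := by
  refine Complex.Gamma_ne_zero fun m h => hy ?_
  simpa using congrArg Complex.im h

lemma Gamma_linePt_add_nat {x y : ℝ} (hy : y ≠ 0) (n : ℕ) :
    Complex.Gamma (linePt (x + n) y) =
      (∏ j ∈ Finset.range n, linePt (x + j) y) * Complex.Gamma (linePt x y) := by
  induction n with
  | zero => simp
  | succ n ih =>
    have h6 : linePt (x + n) y + 1 = linePt (x + (n + 1 : ℕ)) y := by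
      simpa [add_assoc] using linePt_add_ofReal (x + n) 1 y
    rw [← h6, Complex.Gamma_add_one _ (fun h => hy (by simpa using congrArg Complex.im h)), ih,
      Finset.prod_range_succ]
    ring

lemma exists_Gamma_linePt_add_nat_le (σ₁ σ₂ : ℝ) (n : ℕ) :
    ∃ C, 0 ≤ C ∧ ∀ x ∈ Icc σ₁ σ₂, ∀ y, y ≠ 0 →
      ‖Complex.Gamma (linePt (x + n) y)‖ ≤ C * (1 + |y|) ^ n * ‖Complex.Gamma (linePt x y)‖ := by
  refine ⟨(|σ₁| + |σ₂| + n + 1) ^ n, by positivity, fun x hx y hy => ?_⟩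
  rw [Gamma_linePt_add_nat hy, norm_mul, norm_prod, ← mul_pow]
  gcongr
  calc ∏ j ∈ Finset.range n, ‖linePt (x + j) y‖
      ≤ ∏ _j ∈ Finset.range n, (|σ₁| + |σ₂| + n + 1) * (1 + |y|) := by
        refine Finset.prod_le_prod (fun _ _ => norm_nonneg _) fun j hj => ?_
        have h1 := norm_linePt_le (x + j) y
        have h2 : |x + j| ≤ |σ₁| + |σ₂| + n := by
          have h3 : (j : ℝ) ≤ n := by exact_mod_cast (Finset.mem_range.1 hj).le
          have := j.cast_nonneg (α := ℝ)
          rw [abs_le]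
          constructor <;> linarith [hx.1, hx.2, neg_abs_le σ₁, le_abs_self σ₂, abs_nonneg σ₁,
            abs_nonneg σ₂]
        have h4 : 0 ≤ (|σ₁| + |σ₂| + n) * |y| := by positivity
        nlinarith
    _ = _ := by simp

/-- On vertical lines the Gamma function varies at most polynomially with the abscissa. -/
lemma exists_Gamma_ratio_le (σ₁ σ₂ : ℝ) {η : ℝ} (hη : 0 < η) :
    ∃ C, ∃ k : ℕ, 0 ≤ C ∧ ∀ x ∈ Icc σ₁ σ₂, ∀ x' ∈ Icc σ₁ σ₂, ∀ y, η ≤ |y| →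
      ‖Complex.Gamma (linePt x y)‖ ≤ C * (1 + |y|) ^ k * ‖Complex.Gamma (linePt x' y)‖ := by
  -- Translation by n brings the whole interval into the right half plane. Since N exceeds the
  -- length of the interval, x + n ≤ x' + n + N for every pair, so the monotonicity of |Γ(z)|/Γ(Re
  -- z) applies; the functional equation then returns to x' at polynomial cost.
  obtain ⟨n, hn⟩ := exists_nat_gt (-σ₁)
  obtain ⟨N, hN⟩ := exists_nat_gt (σ₂ - σ₁)
  obtain ⟨C, hC0, hC⟩ := exists_Gamma_linePt_add_nat_le σ₁ σ₂ (n + N)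
  have hcont : ContinuousOn Real.Gamma (Ioi 0) := fun x hx =>
    (Real.differentiableAt_Gamma fun m h => by
      have := m.cast_nonneg (α := ℝ); simp at hx; linarith).continuousAt.continuousWithinAt
  obtain ⟨U, hU⟩ := (isCompact_Icc (a := σ₁ + n) (b := σ₂ + n)).exists_bound_of_continuousOn
    (hcont.mono fun x hx => by simp; linarith [hx.1])
  obtain ⟨V, hV⟩ := (isCompact_Icc (a := σ₁ + n + N) (b := σ₂ + n + N)).exists_bound_of_continuousOn
    (f := fun x => (Real.Gamma x)⁻¹)
    (ContinuousOn.inv₀ (hcont.mono fun x hx => by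
        simp; linarith [hx.1, N.cast_nonneg (α := ℝ)]) fun x hx =>
      (Real.Gamma_pos_of_pos (by linarith [hx.1, N.cast_nonneg (α := ℝ)])).ne')
  refine ⟨(η ^ n)⁻¹ * (|U| * |V|) * C, n + N, by positivity, fun x hx x' hx' y hy => ?_⟩
  have hy0 : y ≠ 0 := by rintro rfl; simp at hy; linarith
  -- Each of the n factors of the functional equation has modulus at least |y| ≥ η.
  have h1 : η ^ n * ‖Complex.Gamma (linePt x y)‖ ≤ ‖Complex.Gamma (linePt (x + n) y)‖ := by
    rw [Gamma_linePt_add_nat hy0, norm_mul, norm_prod]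
    gcongr
    calc η ^ n = ∏ _j ∈ Finset.range n, η := by simp
      _ ≤ _ := Finset.prod_le_prod (fun _ _ => hη.le) fun j _ =>
        hy.trans (abs_im_le_norm_linePt _ _)
  have h2 := norm_Gamma_mul_le (x := x + n) (x' := x' + n + N) (by linarith [hx.1])
    (by linarith [hx.2, hx'.1]) y
  have hpos : 0 < Real.Gamma (x' + n + N) :=
    Real.Gamma_pos_of_pos (by linarith [hx'.1, N.cast_nonneg (α := ℝ)])
  have h3 : Real.Gamma (x + n) * (Real.Gamma (x' + n + N))⁻¹ ≤ |U| * |V| := by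
    gcongr
    · exact (le_abs_self _).trans ((hU _ ⟨by linarith [hx.1], by linarith [hx.2]⟩).trans (le_abs_self _))
    · exact (le_abs_self _).trans ((hV _ ⟨by linarith [hx'.1], by linarith [hx'.2]⟩).trans (le_abs_self _))
  have h4 : ‖Complex.Gamma (linePt (x + n) y)‖ ≤
      ‖Complex.Gamma (linePt (x' + n + N) y)‖ * (|U| * |V|) := by
    rw [← le_div_iff₀ hpos] at h2
    refine h2.trans ?_
    rw [div_eq_mul_inv, mul_assoc]
    gcongr
  have h5 := hC x' hx' y hy0
  have h6 : x' + n + N = x' + (n + N : ℕ) := by push_cast; ring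
  rw [← h6] at h5
  have hηn : 0 < η ^ n := by positivity
  have h7 : ‖Complex.Gamma (linePt x y)‖ ≤ (η ^ n)⁻¹ * ‖Complex.Gamma (linePt (x + n) y)‖ := by
    rw [inv_mul_eq_div, le_div_iff₀ hηn, mul_comm]; exact h1
  calc _ ≤ (η ^ n)⁻¹ * ‖Complex.Gamma (linePt (x + n) y)‖ := h7
    _ ≤ (η ^ n)⁻¹ * ((C * (1 + |y|) ^ (n + N) * ‖Complex.Gamma (linePt x' y)‖) * (|U| * |V|)) := by
        gcongr
        exact h4.trans (by gcongr)
    _ = _ := by ring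

/-! ### Polynomial comparison of Fox kernels in a vertical strip -/

/-- `Φ` at abscissae in `s` is dominated, away from the real axis and up to a polynomial factor,
by `Φ` at abscissa `c`. -/
def PolyDominated (s : Set ℝ) (c : ℝ) (Φ : ℂ → ℂ) : Prop :=
  ∃ C, ∃ k : ℕ, 0 ≤ C ∧ ∀ σ ∈ s, ∀ y, 1 ≤ |y| →
    ‖Φ (linePt σ y)‖ ≤ C * (1 + |y|) ^ k * ‖Φ (linePt c y)‖

lemma PolyDominated.mul {s : Set ℝ} {c : ℝ} {Φ Ψ : ℂ → ℂ} (hΦ : PolyDominated s c Φ)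
    (hΨ : PolyDominated s c Ψ) : PolyDominated s c fun v => Φ v * Ψ v := by
  obtain ⟨C, k, hC, h⟩ := hΦ
  obtain ⟨C', k', hC', h'⟩ := hΨ
  refine ⟨C * C', k + k', by positivity, fun σ hσ y hy => ?_⟩
  rw [norm_mul, norm_mul]
  calc _ ≤ (C * (1 + |y|) ^ k * ‖Φ (linePt c y)‖) * (C' * (1 + |y|) ^ k' * ‖Ψ (linePt c y)‖) := by
        gcongr
        · exact h σ hσ y hy
        · exact h' σ hσ y hy
    _ = _ := by ring

lemma PolyDominated.prod {ι : Type*} {s : Set ℝ} {c : ℝ} {Φ : ι → ℂ → ℂ} (t : Finset ι)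
    (h : ∀ i, PolyDominated s c (Φ i)) : PolyDominated s c fun v => ∏ i ∈ t, Φ i v := by
  classical
  induction t using Finset.induction_on with
  | empty => exact ⟨1, 0, zero_le_one, by simp⟩
  | insert i t hi ih =>
    simp only [Finset.prod_insert hi]
    exact (h i).mul ih

lemma linePt_affine (a b c y : ℝ) : (a : ℂ) + b * linePt c y = linePt (a + b * c) (b * y) := by
  simp only [linePt]; push_cast; ring

lemma exists_Gamma_affine_ratio_le (σ₁ σ₂ a : ℝ) {b : ℝ} (hb : b ≠ 0) :
    ∃ C, ∃ k : ℕ, 0 ≤ C ∧ ∀ x ∈ Icc σ₁ σ₂, ∀ x' ∈ Icc σ₁ σ₂, ∀ y, 1 ≤ |y| →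
      ‖Complex.Gamma (a + b * linePt x y)‖ ≤
        C * (1 + |y|) ^ k * ‖Complex.Gamma (a + b * linePt x' y)‖ := by
  obtain ⟨C, k, hC, h⟩ := exists_Gamma_ratio_le (a - |b| * (|σ₁| + |σ₂|)) (a + |b| * (|σ₁| + |σ₂|))
    (abs_pos.2 hb)
  have hmem : ∀ x ∈ Icc σ₁ σ₂, a + b * x ∈
      Icc (a - |b| * (|σ₁| + |σ₂|)) (a + |b| * (|σ₁| + |σ₂|)) := by
    intro x hx
    have h1 : |b * x| ≤ |b| * (|σ₁| + |σ₂|) := by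
      rw [abs_mul]
      gcongr
      rw [abs_le]
      constructor <;> linarith [hx.1, hx.2, neg_abs_le σ₁, le_abs_self σ₂, abs_nonneg σ₁,
        abs_nonneg σ₂]
    rw [abs_le] at h1
    constructor <;> linarith [h1.1, h1.2]
  refine ⟨C * (1 + |b|) ^ k, k, by positivity, fun x hx x' hx' y hy => ?_⟩
  rw [linePt_affine, linePt_affine]
  refine (h _ (hmem x hx) _ (hmem x' hx') (b * y) ?_).trans ?_
  · rw [abs_mul]; exact le_mul_of_one_le_right (abs_nonneg _) hy
  · rw [mul_assoc C ((1 + |b|) ^ k), ← mul_pow]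
    gcongr
    rw [abs_mul]
    nlinarith [abs_nonneg b, abs_nonneg y]

lemma polyDominated_Gamma (σ₁ σ₂ a : ℝ) {b c : ℝ} (hb : b ≠ 0) (hc : c ∈ Icc σ₁ σ₂) :
    PolyDominated (Icc σ₁ σ₂) c fun v => Complex.Gamma (a + b * v) := by
  obtain ⟨C, k, hC, h⟩ := exists_Gamma_affine_ratio_le σ₁ σ₂ a hb
  exact ⟨C, k, hC, fun σ hσ y hy => h σ hσ c hc y hy⟩

/-- The Gamma comparison is symmetric in the two abscissae, so it survives inversion. -/
lemma polyDominated_inv_Gamma (σ₁ σ₂ a : ℝ) {b c : ℝ} (hb : b ≠ 0) (hc : c ∈ Icc σ₁ σ₂) :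
    PolyDominated (Icc σ₁ σ₂) c fun v => (Complex.Gamma (a + b * v))⁻¹ := by
  obtain ⟨C, k, hC, h⟩ := exists_Gamma_affine_ratio_le σ₁ σ₂ a hb
  refine ⟨C, k, hC, fun σ hσ y hy => ?_⟩
  have hy0 : y ≠ 0 := by rintro rfl; simp at hy; linarith
  have hne : ∀ x, 0 < ‖Complex.Gamma (a + b * linePt x y)‖ := fun x => by
    rw [linePt_affine]
    exact norm_pos_iff.2 (Gamma_linePt_ne_zero (mul_ne_zero hb hy0))
  rw [norm_inv, norm_inv, ← div_eq_mul_inv, le_div_iff₀ (hne c), inv_mul_le_iff₀ (hne σ)]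
  refine (h c hc σ hσ y hy).trans (le_of_eq ?_)
  ring

namespace FoxParams

variable {m n p q : ℕ} (F : FoxParams m n p q)

/-- Normal form in which every factor is Γ(a + bv) or its inverse with a, b real. Inverses rather
than a quotient let the entire function 1/Γ be used at the poles of the denominator. -/
lemma kernel_eq (v : ℂ) : F.kernel v =
    ((∏ i ∈ Finset.univ.filter (fun i : Fin q => i.val < m), Complex.Gamma (F.b i + F.B i * v)) *
      ∏ i ∈ Finset.univ.filter (fun i : Fin p => i.val < n),
        Complex.Gamma ((1 - F.a i : ℝ) + (-F.A i : ℝ) * v)) *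
    ((∏ i ∈ Finset.univ.filter (fun i : Fin p => n ≤ i.val),
        (Complex.Gamma (F.a i + F.A i * v))⁻¹) *
      ∏ i ∈ Finset.univ.filter (fun i : Fin q => m ≤ i.val),
        (Complex.Gamma ((1 - F.b i : ℝ) + (-F.B i : ℝ) * v))⁻¹) := by
  have h : ∀ a b : ℝ, (1 - a - b * v : ℂ) = (1 - a : ℝ) + (-b : ℝ) * v := fun a b => by
    push_cast; ring
  rw [kernel, div_eq_mul_inv, mul_inv, ← Finset.prod_inv_distrib, ← Finset.prod_inv_distrib]
  simp only [h]

variable {F}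

lemma polyDominated_kernel (hA : ∀ i, 0 < F.A i) (hB : ∀ i, 0 < F.B i) {σ₁ σ₂ c : ℝ}
    (hc : c ∈ Icc σ₁ σ₂) : PolyDominated (Icc σ₁ σ₂) c F.kernel := by
  rw [show F.kernel = _ from funext F.kernel_eq]
  exact ((PolyDominated.prod _ fun i => polyDominated_Gamma _ _ _ (hB i).ne' hc).mul
    (PolyDominated.prod _ fun i => polyDominated_Gamma _ _ _ (neg_ne_zero.2 (hA i).ne') hc)).mul
    ((PolyDominated.prod _ fun i => polyDominated_inv_Gamma _ _ _ (hA i).ne' hc).mul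
    (PolyDominated.prod _ fun i => polyDominated_inv_Gamma _ _ _ (neg_ne_zero.2 (hB i).ne') hc))

lemma Separates.of_mem_Icc {σ₁ σ₂ : ℝ} (h₁ : F.Separates σ₁) (h₂ : F.Separates σ₂) {σ : ℝ}
    (hσ : σ ∈ Icc σ₁ σ₂) : F.Separates σ := by
  have key : ∀ a b : ℝ, 0 < a + b * σ₁ → 0 < a + b * σ₂ → 0 < a + b * σ := fun a b h1 h2 => by
    rcases le_total 0 b with hb | hb
    · nlinarith [hσ.1]
    · nlinarith [hσ.2]
  refine ⟨fun i hi => key _ _ (h₁.1 i hi) (h₂.1 i hi), fun i hi => ?_⟩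
  have := key (1 - F.a i) (-F.A i) (by linarith [h₁.2 i hi]) (by linarith [h₂.2 i hi])
  linarith

lemma differentiableAt_kernel {v : ℂ} (h : F.Separates v.re) : DifferentiableAt ℂ F.kernel v := by
  rw [show F.kernel = _ from funext F.kernel_eq]
  have hG : ∀ a b : ℝ, 0 < a + b * v.re →
      DifferentiableAt ℂ (fun v => Complex.Gamma (a + b * v)) v := fun a b h => by
    refine DifferentiableAt.comp (g := Complex.Gamma) v
      (Complex.differentiableAt_Gamma _ fun m hm => ?_) (by fun_prop)
    have := congrArg Complex.re hm
    simp at this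
    linarith [m.cast_nonneg (α := ℝ)]
  have hG' : ∀ a b : ℝ, DifferentiableAt ℂ (fun v => (Complex.Gamma (a + b * v))⁻¹) v := fun a b =>
    DifferentiableAt.comp (g := fun s => (Complex.Gamma s)⁻¹) v
      (Complex.differentiable_one_div_Gamma _) (by fun_prop)
  refine ((DifferentiableAt.fun_finsetProd fun i hi => ?_).mul
    (DifferentiableAt.fun_finsetProd fun i hi => ?_)).mul
    ((DifferentiableAt.fun_finsetProd fun i _ => hG' _ _).mul
    (DifferentiableAt.fun_finsetProd fun i _ => hG' _ _))
  · exact hG _ _ (h.1 i (Finset.mem_filter.1 hi).2)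
  · exact hG _ _ (by linarith [h.2 i (Finset.mem_filter.1 hi).2])

lemma continuous_kernel_linePt {c : ℝ} (h : F.Separates c) :
    Continuous fun y => F.kernel (linePt c y) :=
  continuous_iff_continuousAt.2 fun y =>
    (differentiableAt_kernel (by simpa)).continuousAt.comp (continuous_linePt c).continuousAt

/-- If the kernel is integrable on one separating line, it is dominated, uniformly on a strip of
separating lines, by an integrable function times a polynomial. -/
lemma exists_kernel_bound (hA : ∀ i, 0 < F.A i) (hB : ∀ i, 0 < F.B i) {σ₁ σ₂ c : ℝ}
    (h₁ : F.Separates σ₁) (h₂ : F.Separates σ₂) (hc : c ∈ Icc σ₁ σ₂) (hconv : F.Converges c) :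
    ∃ k : ℕ, ∃ g : ℝ → ℝ, Integrable g ∧
      ∀ σ ∈ Icc σ₁ σ₂, ∀ y, ‖F.kernel (linePt σ y)‖ ≤ (1 + |y|) ^ k * g y := by
  obtain ⟨C, k, hC, h⟩ := polyDominated_kernel hA hB hc
  -- The Gamma comparison needs |y| ≥ 1; the remaining compact rectangle is handled by continuity,
  -- since all its abscissae separate the poles.
  have hK : ContinuousOn F.kernel (Icc σ₁ σ₂ ×ℂ Icc (-1) 1) := fun v hv =>
    (differentiableAt_kernel (h₁.of_mem_Icc h₂ hv.1)).continuousAt.continuousWithinAt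
  obtain ⟨M, hM⟩ := (isCompact_Icc.reProdIm isCompact_Icc).exists_bound_of_continuousOn hK
  refine ⟨k, fun y => C * ‖F.kernel (linePt c y)‖ + (Icc (-1 : ℝ) 1).indicator (fun _ => |M|) y,
    (hconv.norm.const_mul C).add ((integrable_indicator_iff measurableSet_Icc).2
      (integrableOn_const (by simp))), fun σ hσ y => ?_⟩
  have h1 : 1 ≤ (1 + |y|) ^ k := one_le_pow₀ (by linarith [abs_nonneg y])
  by_cases hy : y ∈ Icc (-1 : ℝ) 1
  · have h2 := hM (linePt σ y) ⟨by simpa using hσ, by simpa using hy⟩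
    beta_reduce
    rw [indicator_of_mem hy]
    have h3 : 0 ≤ C * ‖F.kernel (linePt c y)‖ := by positivity
    nlinarith [le_abs_self M, abs_nonneg M]
  · have h2 : 1 ≤ |y| := by
      by_contra hlt
      exact hy (abs_le.1 (not_le.1 hlt).le)
    beta_reduce
    rw [indicator_of_notMem hy]
    refine (h σ hσ y h2).trans (le_of_eq ?_)
    ring

end FoxParams

/-! ### Shifting a vertical contour -/

/-- A vertical contour may be shifted across a strip on which the integrand is holomorphic and
dominated by an integrable function of the ordinate. -/
lemma integral_linePt_eq_of_dominated {Φ : ℂ → ℂ} {σ₁ σ₂ : ℝ} (hσ : σ₁ ≤ σ₂)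
    (hΦ : ∀ v : ℂ, v.re ∈ Icc σ₁ σ₂ → DifferentiableAt ℂ Φ v) {h : ℝ → ℝ} (hh : Integrable h)
    (hb : ∀ σ ∈ Icc σ₁ σ₂, ∀ y, ‖Φ (linePt σ y)‖ ≤ h y) :
    ∫ y, Φ (linePt σ₁ y) = ∫ y, Φ (linePt σ₂ y) := by
  have hint : ∀ σ ∈ Icc σ₁ σ₂, Integrable fun y => Φ (linePt σ y) := fun σ hσ =>
    hh.mono' (continuous_iff_continuousAt.2 fun y => (hΦ _ (by simpa)).continuousAt.comp
      (continuous_linePt σ).continuousAt).aestronglyMeasurable (ae_of_all _ (hb σ hσ))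
  have hlim : ∀ σ ∈ Icc σ₁ σ₂, Tendsto (fun T : ℝ => ∫ y in (-T)..T, Φ (linePt σ y)) atTop
      (𝓝 (∫ y, Φ (linePt σ y))) := fun σ hσ =>
    intervalIntegral_tendsto_integral (hint σ hσ) tendsto_neg_atTop_atBot tendsto_id
  have hD := ((hlim σ₂ (right_mem_Icc.2 hσ)).sub (hlim σ₁ (left_mem_Icc.2 hσ))).norm
  -- By Cauchy's theorem on the rectangle of height 2T, the difference of the truncated integrals
  -- equals, up to the factor i, the contribution of the two horizontal sides.
  have hbound : ∀ T : ℝ, ‖(∫ y in (-T)..T, Φ (linePt σ₂ y)) - ∫ y in (-T)..T, Φ (linePt σ₁ y)‖ ≤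
      (σ₂ - σ₁) * (h T + h (-T)) := by
    intro T
    have hrect := Complex.integral_boundary_rect_eq_zero_of_differentiableOn Φ
      (linePt σ₁ (-T)) (linePt σ₂ T) (fun v hv => by
        have := hv.1
        simp only [linePt_re, mem_preimage, uIcc_of_le hσ] at this
        exact (hΦ v this).differentiableWithinAt)
    simp only [linePt_re, linePt_im] at hrect
    have hn : ∀ y : ℝ, ‖∫ x : ℝ in σ₁..σ₂, Φ (x + y * Complex.I)‖ ≤ (σ₂ - σ₁) * h y := by
      intro y
      refine (intervalIntegral.norm_integral_le_of_norm_le_const (C := h y) fun x hx => ?_).trans ?_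
      · rw [uIoc_of_le hσ] at hx
        exact hb x ⟨hx.1.le, hx.2⟩ y
      · rw [abs_of_nonneg (by linarith), mul_comm]
    change _ - _ + Complex.I • (∫ y in (-T)..T, Φ (linePt σ₂ y)) -
      Complex.I • (∫ y in (-T)..T, Φ (linePt σ₁ y)) = 0 at hrect
    have h2 : Complex.I • ((∫ y in (-T)..T, Φ (linePt σ₂ y)) - ∫ y in (-T)..T, Φ (linePt σ₁ y)) =
        (∫ x : ℝ in σ₁..σ₂, Φ (x + (T : ℝ) * Complex.I)) -
          ∫ x : ℝ in σ₁..σ₂, Φ (x + ((-T : ℝ) : ℂ) * Complex.I) := by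
      rw [smul_sub]
      linear_combination hrect
    have h3 := congrArg norm h2
    rw [norm_smul, Complex.norm_I, one_mul] at h3
    rw [h3]
    refine (norm_sub_le _ _).trans ?_
    linarith [hn T, hn (-T)]
  have hint' : Integrable fun T : ℝ =>
      (∫ y in (-T)..T, Φ (linePt σ₂ y)) - ∫ y in (-T)..T, Φ (linePt σ₁ y) := by
    refine Integrable.mono' ((hh.add hh.comp_neg).const_mul (σ₂ - σ₁)) ?_ (ae_of_all _ hbound)
    have hc : ∀ σ ∈ Icc σ₁ σ₂, Continuous fun T : ℝ => ∫ y in (-T)..T, Φ (linePt σ y) := by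
      intro σ hσ
      have h1 : ∀ T : ℝ, ∫ y in (-T)..T, Φ (linePt σ y) =
          (∫ y in (0:ℝ)..T, Φ (linePt σ y)) - ∫ y in (0:ℝ)..(-T), Φ (linePt σ y) := fun T => by
        rw [intervalIntegral.integral_interval_sub_left] <;>
          exact (hint σ hσ).intervalIntegrable
      have h2 : Continuous fun T : ℝ => ∫ y in (0:ℝ)..T, Φ (linePt σ y) :=
        intervalIntegral.continuous_primitive (fun a b => (hint σ hσ).intervalIntegrable) 0
      simp only [h1]
      exact h2.sub (h2.comp continuous_neg)
    exact ((hc σ₂ (right_mem_Icc.2 hσ)).sub (hc σ₁ (left_mem_Icc.2 hσ))).aestronglyMeasurable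
  -- As a function of T the difference converges at infinity and is also integrable, so its limit is
  -- 0. No pointwise decay of `h` is needed.
  have hz := IntegrableAtFilter.eq_zero_of_tendsto (μ := volume) (l := atTop) (f := fun T : ℝ =>
    ‖(∫ y in (-T)..T, Φ (linePt σ₂ y)) - ∫ y in (-T)..T, Φ (linePt σ₁ y)‖)
    ⟨univ, univ_mem, hint'.norm.integrableOn⟩ (fun s hs => by
      obtain ⟨a, ha⟩ := mem_atTop_sets.1 hs
      exact top_le_iff.1 (le_trans (by simp) (measure_mono (μ := volume) (fun x hx => ha x hx : Ici a ⊆ s)))) hD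
  exact (sub_eq_zero.1 (norm_eq_zero.1 hz)).symm

/-! ### The bivariate integrand and its absolute convergence -/

@[fun_prop]
lemma measurable_linePt (c : ℝ) : Measurable (linePt c) := (continuous_linePt c).measurable

lemma norm_ofReal_cpow_neg_linePt {x : ℝ} (hx : 0 < x) (c y : ℝ) :
    ‖(x : ℂ) ^ (-linePt c y)‖ = x ^ (-c) := by
  rw [Complex.norm_cpow_eq_rpow_re_of_pos hx]; simp

lemma norm_ofReal_cpow_linePt {x : ℝ} (hx : 0 < x) (c y : ℝ) :
    ‖(x : ℂ) ^ linePt c y‖ = x ^ c := by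
  rw [Complex.norm_cpow_eq_rpow_re_of_pos hx]; simp

lemma neg_linePt_sub_linePt (c d y u : ℝ) :
    -linePt c y - linePt d u = linePt (-c - d) (-(y + u)) := by
  simp only [linePt]; push_cast; ring

lemma linePt_ne_zero {c : ℝ} (hc : c ≠ 0) (y : ℝ) : linePt c y ≠ 0 := fun h =>
  hc (by simpa using congrArg Complex.re h)

lemma one_add_linePt (c y : ℝ) : 1 + linePt c y = linePt (1 + c) y := by
  simp only [linePt]; push_cast; ring

lemma linePt_add_one (c y : ℝ) : linePt c y + 1 = linePt (c + 1) y := by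
  simp only [linePt]; push_cast; ring

lemma one_sub_linePt (c y : ℝ) : 1 - linePt c y = linePt (1 - c) (-y) := by
  simp only [linePt]; push_cast; ring

lemma norm_Gamma_linePt_neg (c y : ℝ) :
    ‖Complex.Gamma (linePt c (-y))‖ = ‖Complex.Gamma (linePt c y)‖ := by
  have : linePt c (-y) = (starRingEnd ℂ) (linePt c y) := by
    simp [linePt]
  rw [this, Complex.Gamma_conj, Complex.norm_conj]

/-- The adjoined pair (0, 1) contributes Γ(v), and adding A, B to a, b amounts to v ↦ v + 1. Thus
the bivariate contour Re v = c corresponds to the line c + 1 for the original kernel. -/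
lemma FoxParams.shift_kernel {m n p q : ℕ} (F : FoxParams m n p q) (v : ℂ) :
    F.shift.kernel v = Complex.Gamma v * F.kernel (v + 1) := by
  have h1 : ∀ a b : ℝ, ((a + b : ℝ) : ℂ) + b * v = a + b * (v + 1) := fun a b => by
    push_cast; ring
  have h2 : ∀ a b : ℝ, 1 - ((a + b : ℝ) : ℂ) - b * v = 1 - a - b * (v + 1) := fun a b => by
    push_cast; ring
  simp only [FoxParams.kernel, FoxParams.shift, Finset.prod_filter, Fin.prod_univ_succ, h1, h2,
    Fin.cons_zero, Fin.cons_succ, Fin.val_succ, Fin.val_zero, Nat.add_lt_add_iff_right,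
    Nat.add_le_add_iff_right]
  simp
  ring

lemma FoxParams.separates_of_shift {m n p q : ℕ} {F : FoxParams m n p q} {c : ℝ}
    (h : F.shift.Separates c) : 0 < c ∧ F.Separates (c + 1) := by
  refine ⟨?_, fun i hi => ?_, fun i hi => ?_⟩
  · simpa [FoxParams.shift] using h.1 0 (by simp)
  · have := h.1 i.succ (by simpa using hi)
    simp [FoxParams.shift] at this
    linarith
  · have := h.2 i hi
    simp [FoxParams.shift] at this
    linarith

lemma asepCross_kernel (v s : ℂ) : asepCross.kernel v s = Complex.Gamma (-v - s) := by
  simp [FoxCross.kernel, asepCross]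

lemma asepSecond_kernel (s : ℂ) :
    asepSecond.kernel s = Complex.Gamma (1 + s) / Complex.Gamma (1 - s) := by
  simp [FoxParams.kernel, asepSecond, Finset.prod_filter]

/-- Together these inequalities force 0 < c < 1 and -1 < d < 0, so d lies in the strip where the
Mellin transform of 1 - exp(-t) exists. -/
lemma foxH2Separates_asep {m n p q : ℕ} {F : FoxParams m n p q} {c d : ℝ}
    (h : foxH2Separates asepCross F.shift asepSecond c d) :
    0 < c ∧ F.Separates (c + 1) ∧ -1 < d ∧ c + d < 0 := by
  obtain ⟨h1, h2, h3⟩ := h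
  refine ⟨(FoxParams.separates_of_shift h1).1, (FoxParams.separates_of_shift h1).2, ?_, ?_⟩
  · have := h2.1 0 (by simp)
    simp [asepSecond] at this
    linarith
  · have := h3 0 (by simp)
    simp [asepCross] at this
    linarith

lemma foxH2Integrand_asep {m n p q : ℕ} (F : FoxParams m n p q) (c d x y : ℝ) (w : ℝ × ℝ) :
    foxH2Integrand asepCross F.shift asepSecond c d x y w =
      Complex.Gamma (-linePt c w.1 - linePt d w.2) *
      (Complex.Gamma (linePt c w.1) * F.kernel (linePt (c + 1) w.1)) *
      (Complex.Gamma (1 + linePt d w.2) / Complex.Gamma (1 - linePt d w.2)) *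
      (x : ℂ) ^ (-linePt c w.1) * (y : ℂ) ^ (-linePt d w.2) := by
  rw [foxH2Integrand, F.shift_kernel, asepCross_kernel, asepSecond_kernel, linePt_add_one]

/-- A Gamma factor on a line in the right half plane absorbs the growth of the kernel on another
separating line. -/
lemma FoxParams.integrable_Gamma_mul_kernel {m n p q : ℕ} {F : FoxParams m n p q}
    (hA : ∀ i, 0 < F.A i) (hB : ∀ i, 0 < F.B i) {c₀ σ c : ℝ} (h₀ : F.Separates c₀)
    (hσ : F.Separates σ) (hconv : F.Converges c₀) (hc : 0 < c) :
    Integrable fun y => Complex.Gamma (linePt c y) * F.kernel (linePt σ y) := by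
  have hsep : F.Separates (min c₀ σ) ∧ F.Separates (max c₀ σ) := by
    rcases le_total c₀ σ with h | h <;> simp [h, h₀, hσ]
  obtain ⟨k, g, hg, hb⟩ := exists_kernel_bound hA hB hsep.1 hsep.2 (c := c₀) (by simp) hconv
  obtain ⟨C, hC0, hC⟩ := exists_norm_Gamma_decay k hc
  refine (hg.const_mul C).mono' ((continuous_Gamma_linePt hc).mul
    (continuous_kernel_linePt hσ)).aestronglyMeasurable (ae_of_all _ fun y => ?_)
  rw [norm_mul]
  have h1 := hb σ (by simp) y
  have h2 : 0 < (1 + |y|) ^ k := by positivity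
  have h3 : 0 ≤ g y := by
    have := (norm_nonneg _).trans h1
    exact nonneg_of_mul_nonneg_right this h2
  calc _ ≤ ‖Complex.Gamma (linePt c y)‖ * ((1 + |y|) ^ k * g y) := by gcongr
    _ = ‖Complex.Gamma (linePt c y)‖ * (1 + |y|) ^ k * g y := by ring
    _ ≤ _ := by gcongr; exact hC y

/-- After the measure-preserving shear (y, u) ↦ (y, y + u) the factor Γ(-v-s) depends on the second
coordinate only. The rest is Γ(v) times the kernel, integrable in y, and a bounded factor. -/
lemma integrable_foxH2Integrand_asep {m n p q : ℕ} {F : FoxParams m n p q}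
    (hA : ∀ i, 0 < F.A i) (hB : ∀ i, 0 < F.B i) {c₀ c d : ℝ} (h₀ : F.Separates c₀)
    (hconv : F.Converges c₀) (hc : 0 < c) (hσ : F.Separates (c + 1)) (hd : -1 < d)
    (hcd : c + d < 0) {x y : ℝ} (hx : 0 < x) (hy : 0 < y) :
    Integrable (foxH2Integrand asepCross F.shift asepSecond c d x y) := by
  have h1 := F.integrable_Gamma_mul_kernel hA hB h₀ hσ hconv hc
  have h2 : Integrable fun t : ℝ => Complex.Gamma (linePt (-c - d) (-t)) :=
    (integrable_Gamma_linePt (by linarith)).comp_neg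
  have h3 := ((measurePreserving_prod_add (volume : Measure ℝ) (volume : Measure ℝ)).integrable_comp
    (h1.mul_prod h2).aestronglyMeasurable).2 (h1.mul_prod h2)
  have hR : Measurable fun u : ℝ => Complex.Gamma (1 + linePt d u) / Complex.Gamma (1 - linePt d u) := by
    simp only [one_add_linePt, one_sub_linePt]
    exact (continuous_Gamma_linePt (by linarith)).measurable.div
      ((continuous_Gamma_linePt (by linarith)).comp continuous_neg).measurable
  -- The ratio Γ(1+s)/Γ(1-s) is bounded on Re s = d: as d < 0, the abscissa 1 + d is at most 1 - d,
  -- and |Γ(z)|/Γ(Re z) increases with Re z.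
  have h4 := h3.bdd_mul (c := Real.Gamma (1 + d) / Real.Gamma (1 - d) * x ^ (-c) * y ^ (-d))
    (f := fun w : ℝ × ℝ => (Complex.Gamma (1 + linePt d w.2) / Complex.Gamma (1 - linePt d w.2)) *
      (x : ℂ) ^ (-linePt c w.1) * (y : ℂ) ^ (-linePt d w.2))
    (((hR.comp measurable_snd).mul (by fun_prop)).mul (by fun_prop)).aestronglyMeasurable
    (ae_of_all _ fun w => by
      rw [norm_mul, norm_mul, norm_ofReal_cpow_neg_linePt hx, norm_ofReal_cpow_neg_linePt hy]
      gcongr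
      rw [norm_div, one_add_linePt, one_sub_linePt, norm_Gamma_linePt_neg,
        div_le_div_iff₀ (norm_pos_iff.2 (Complex.Gamma_ne_zero_of_re_pos (by simp; linarith)))
          (Real.Gamma_pos_of_pos (by linarith)), mul_comm (Real.Gamma (1 + d))]
      exact norm_Gamma_mul_le (by linarith) (by linarith) _)
  refine h4.congr (ae_of_all _ fun w => ?_)
  simp only [foxH2Integrand_asep, neg_linePt_sub_linePt, Function.comp]
  ring

/-! ### The Mellin transform of `1 - exp (-t)` -/

/-- The function is O(t) at 0 and O(1) at infinity, which gives exactly this strip. -/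
lemma mellinConvergent_one_sub_exp_neg {s : ℂ} (h₁ : -1 < s.re) (h₂ : s.re < 0) :
    MellinConvergent (fun t : ℝ => ((1 - Real.exp (-t) : ℝ) : ℂ)) s := by
  have hc : Continuous fun t : ℝ => ((1 - Real.exp (-t) : ℝ) : ℂ) := by fun_prop
  refine mellinConvergent_of_isBigO_rpow (a := 0) (b := -1)
    (hc.locallyIntegrable.locallyIntegrableOn _) ?_ h₂ ?_ h₁
  · refine Asymptotics.IsBigO.of_bound 1 ?_
    filter_upwards [eventually_gt_atTop (0 : ℝ)] with t ht
    rw [Complex.norm_real]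
    simp only [neg_zero, Real.rpow_zero, norm_one, mul_one, Real.norm_eq_abs]
    have h := Real.exp_pos (-t)
    have h' : Real.exp (-t) ≤ 1 := Real.exp_le_one_iff.2 (by linarith)
    rw [abs_le]; constructor <;> linarith
  · refine Asymptotics.IsBigO.of_bound 1 ?_
    filter_upwards [self_mem_nhdsWithin] with t ht
    rw [Complex.norm_real]
    simp only [neg_neg, Real.rpow_one, one_mul, Real.norm_eq_abs]
    have ht : 0 < t := ht
    have h := Real.add_one_le_exp (-t)
    have h' : Real.exp (-t) ≤ 1 := Real.exp_le_one_iff.2 (by linarith)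
    rw [abs_of_pos ht, abs_le]; constructor <;> linarith

/-- Integration by parts against t^s/s. The boundary terms vanish at 0 because 1 + Re s > 0 and at
infinity because Re s < 0. -/
lemma mellin_one_sub_exp_neg {s : ℂ} (h₁ : -1 < s.re) (h₂ : s.re < 0) :
    mellin (fun t : ℝ => ((1 - Real.exp (-t) : ℝ) : ℂ)) s = Complex.Gamma (1 + s) / -s := by
  have hs : s ≠ 0 := by rintro rfl; simp at h₂
  have hΓ : IntegrableOn (fun t : ℝ => (Real.exp (-t) : ℂ) * (t : ℂ) ^ s) (Ioi 0) := by
    simpa using Complex.GammaIntegral_convergent (s := 1 + s) (by simp; linarith)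
  have key := integral_Ioi_mul_deriv_eq_deriv_mul (a := 0)
    (u := fun t : ℝ => ((1 - Real.exp (-t) : ℝ) : ℂ)) (u' := fun t => (Real.exp (-t) : ℂ))
    (v := fun t : ℝ => (t : ℂ) ^ s / s) (v' := fun t : ℝ => (t : ℂ) ^ (s - 1)) (a' := 0) (b' := 0)
    (fun t _ => by
      have := (((hasDerivAt_neg t).exp).const_sub 1).ofReal_comp
      simpa using this)
    (fun t ht => by
      have := hasDerivAt_ofReal_cpow_const' (ne_of_gt ht) (r := s - 1)
        (by intro h; exact hs (by linear_combination h))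
      rwa [sub_add_cancel] at this)
    ((mellinConvergent_one_sub_exp_neg h₁ h₂).congr_fun (fun t _ => by simp [mul_comm])
      measurableSet_Ioi)
    (IntegrableOn.congr_fun (hΓ.div_const s) (fun t _ => by simp [mul_div_assoc])
      measurableSet_Ioi)
    ?_ ?_
  · rw [mellin]
    simp only [smul_eq_mul, mul_comm ((_ : ℂ) ^ (s - 1))]
    rw [key, Complex.Gamma_eq_integral (by simp; linarith), Complex.GammaIntegral]
    simp only [← mul_div_assoc, integral_div]
    simp [div_neg]
  · rw [tendsto_zero_iff_norm_tendsto_zero]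
    have hlim : Tendsto (fun t : ℝ => t * t ^ s.re / ‖s‖) (𝓝[>] 0) (𝓝 0) := by
      have h1 : Tendsto (fun t : ℝ => t ^ (1 + s.re) / ‖s‖) (𝓝[>] 0) (𝓝 0) := by
        have := ((Real.continuousAt_rpow_const 0 (1 + s.re) (Or.inr (by linarith))).tendsto.div_const
          ‖s‖).mono_left (nhdsWithin_le_nhds (s := Ioi 0))
        rwa [Real.zero_rpow (by linarith), zero_div] at this
      refine h1.congr' ?_
      filter_upwards [self_mem_nhdsWithin] with t ht
      rw [Real.rpow_add ht, Real.rpow_one]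
    refine squeeze_zero' (Eventually.of_forall fun t => norm_nonneg _) ?_ hlim
    filter_upwards [self_mem_nhdsWithin] with t ht
    have ht : 0 < t := ht
    simp only [Pi.mul_apply, norm_mul, norm_div, Complex.norm_real,
      Complex.norm_cpow_eq_rpow_re_of_pos ht]
    rw [mul_div_assoc]
    gcongr
    have h := Real.add_one_le_exp (-t)
    have h' : Real.exp (-t) ≤ 1 := Real.exp_le_one_iff.2 (by linarith)
    rw [Real.norm_eq_abs, abs_le]; constructor <;> linarith
  · rw [tendsto_zero_iff_norm_tendsto_zero]
    have hlim : Tendsto (fun t : ℝ => t ^ s.re / ‖s‖) atTop (𝓝 0) := by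
      have := (tendsto_rpow_neg_atTop (y := -s.re) (by linarith)).div_const ‖s‖
      simpa using this
    refine squeeze_zero' (Eventually.of_forall fun t => norm_nonneg _) ?_ hlim
    filter_upwards [eventually_gt_atTop (0 : ℝ)] with t ht
    simp only [Pi.mul_apply, norm_mul, norm_div, Complex.norm_real,
      Complex.norm_cpow_eq_rpow_re_of_pos ht]
    refine mul_le_of_le_one_left (by positivity) ?_
    have h := Real.exp_pos (-t)
    have h' : Real.exp (-t) ≤ 1 := Real.exp_le_one_iff.2 (by linarith)
    rw [Real.norm_eq_abs, abs_le]; constructor <;> linarith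

lemma integrable_Gamma_one_add_div_neg {d : ℝ} (h₁ : -1 < d) (h₂ : d < 0) :
    Integrable fun u => Complex.Gamma (1 + linePt d u) / -linePt d u := by
  have h := integrable_Gamma_linePt (x := 1 + d) (by linarith)
  refine (h.norm.const_mul (|d|⁻¹)).mono' ?_ (ae_of_all _ fun u => ?_)
  · simp only [one_add_linePt]
    exact (h.aestronglyMeasurable.aemeasurable.div
      (measurable_linePt d).neg.aemeasurable).aestronglyMeasurable
  · rw [norm_div, norm_neg, one_add_linePt, div_eq_inv_mul]
    have : |d| ≤ ‖linePt d u‖ := by simpa using Complex.abs_re_le_norm (linePt d u)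
    gcongr
    exact abs_pos.2 h₂.ne

lemma one_sub_exp_neg_eq_integral {d : ℝ} (h₁ : -1 < d) (h₂ : d < 0) {w : ℝ} (hw : 0 < w) :
    ((1 - Real.exp (-w) : ℝ) : ℂ) = (1 / (2 * (Real.pi : ℂ))) *
      ∫ u : ℝ, Complex.Gamma (1 + linePt d u) / -linePt d u * (w : ℂ) ^ (-linePt d u) := by
  have hm : ∀ u : ℝ, mellin (fun t : ℝ => ((1 - Real.exp (-t) : ℝ) : ℂ)) (d + u * Complex.I) =
      Complex.Gamma (1 + linePt d u) / -linePt d u := fun u =>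
    mellin_one_sub_exp_neg (s := linePt d u) (by simpa) (by simpa)
  have key := mellinInv_mellin_eq d (fun t : ℝ => ((1 - Real.exp (-t) : ℝ) : ℂ)) hw
    (mellinConvergent_one_sub_exp_neg (by simpa) (by simpa))
    (by
      unfold Complex.VerticalIntegrable
      simp only [hm]
      exact integrable_Gamma_one_add_div_neg h₁ h₂)
    (Continuous.continuousAt (by fun_prop))
  rw [← key, mellinInv]
  simp only [hm]
  simp only [smul_eq_mul, Complex.real_smul]
  push_cast
  congr 2
  funext u
  rw [mul_comm]; rfl

/-! ### The Beta integral over the half line -/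

lemma ofReal_cpow_eq_exp {t : ℝ} (ht : 0 < t) (z : ℂ) :
    (t : ℂ) ^ z = Complex.exp (z * Real.log t) := by
  rw [Complex.cpow_def_of_ne_zero (by exact_mod_cast ht.ne'), ← Complex.ofReal_log ht.le, mul_comm]

lemma image_mul_div_one_sub {r : ℝ} (hr : 0 < r) :
    (fun w : ℝ => r * w / (1 - w)) '' Ioo 0 1 = Ioi 0 := by
  ext x
  constructor
  · rintro ⟨w, hw, rfl⟩
    exact div_pos (mul_pos hr hw.1) (by linarith [hw.2])
  · intro hx
    have hx : 0 < x := hx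
    refine ⟨x / (x + r), ⟨by positivity, (div_lt_one (by positivity)).2 (by linarith)⟩, ?_⟩
    have : (x + r) ≠ 0 := by positivity
    have h2 : 1 - x / (x + r) = r / (x + r) := by field_simp; ring
    simp only [h2]
    field_simp

lemma hasDerivWithinAt_mul_div_one_sub (r : ℝ) {w : ℝ} (hw : w ∈ Ioo (0 : ℝ) 1) :
    HasDerivWithinAt (fun w : ℝ => r * w / (1 - w)) (r / (1 - w) ^ 2) (Ioo 0 1) w := by
  have h1 : 1 - w ≠ 0 := by linarith [hw.2]
  have := ((hasDerivAt_id w).const_mul r).div ((hasDerivAt_id w).const_sub 1) h1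
  refine (this.congr_deriv ?_).hasDerivWithinAt
  simp
  ring

lemma injOn_mul_div_one_sub {r : ℝ} (hr : 0 < r) :
    InjOn (fun w : ℝ => r * w / (1 - w)) (Ioo 0 1) := by
  intro w hw w' hw' h
  have h1 : 1 - w ≠ 0 := by linarith [hw.2]
  have h2 : 1 - w' ≠ 0 := by linarith [hw'.2]
  simp only at h
  rw [div_eq_div_iff h1 h2] at h
  have : r * (w - w') = 0 := by linear_combination h
  rcases mul_eq_zero.1 this with h | h
  · exact absurd h hr.ne'
  · linarith

/-- The substitution x = rw/(1-w), Jacobian included, turns the half-line integrand into the Beta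
integrand on (0, 1). All powers have positive bases, so the identity reduces to comparing exponents.
-/
lemma mul_div_one_sub_smul {r : ℝ} (hr : 0 < r) (a b : ℂ) {w : ℝ} (hw : w ∈ Ioo (0 : ℝ) 1) :
    |r / (1 - w) ^ 2| • (((r * w / (1 - w) : ℝ) : ℂ) ^ (a - 1) *
      ((r * w / (1 - w) + r : ℝ) : ℂ) ^ (-(a + b))) =
    (r : ℂ) ^ (-b) * ((w : ℂ) ^ (a - 1) * (1 - (w : ℂ)) ^ (b - 1)) := by
  have hw0 := hw.1
  have h1 : 0 < 1 - w := by linarith [hw.2]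
  have h2 : r * w / (1 - w) + r = r / (1 - w) := by field_simp; ring
  have h3 : (1 - (w : ℂ)) = ((1 - w : ℝ) : ℂ) := by push_cast; ring
  have h4 : ((|r / (1 - w) ^ 2| : ℝ) : ℂ) =
      Complex.exp (Real.log r - 2 * Real.log (1 - w)) := by
    rw [abs_of_pos (by positivity)]
    have : r / (1 - w) ^ 2 = Real.exp (Real.log r - 2 * Real.log (1 - w)) := by
      rw [Real.exp_sub, Real.exp_log hr, two_mul, Real.exp_add, Real.exp_log h1, sq]
    rw [this]; push_cast; rfl
  rw [Complex.real_smul, h4, h2, h3, ofReal_cpow_eq_exp (by positivity),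
    ofReal_cpow_eq_exp (by positivity), ofReal_cpow_eq_exp hr, ofReal_cpow_eq_exp hw0,
    ofReal_cpow_eq_exp h1, ← Complex.exp_add, ← Complex.exp_add, ← Complex.exp_add,
    ← Complex.exp_add, Real.log_div (by positivity) h1.ne', Real.log_mul hr.ne' hw0.ne',
    Real.log_div hr.ne' h1.ne']
  congr 1
  push_cast
  ring

lemma intervalIntegrable_iff_Ioo {f : ℝ → ℂ} :
    IntervalIntegrable f volume 0 1 ↔ IntegrableOn f (Ioo 0 1) := by
  rw [intervalIntegrable_iff_integrableOn_Ioc_of_le zero_le_one, integrableOn_Ioc_iff_integrableOn_Ioo]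

lemma integrableOn_Ioi_cpow_mul_add_cpow {a b : ℂ} (ha : 0 < a.re) (hb : 0 < b.re) {r : ℝ}
    (hr : 0 < r) :
    IntegrableOn (fun x : ℝ => (x : ℂ) ^ (a - 1) * ((x + r : ℝ) : ℂ) ^ (-(a + b))) (Ioi 0) := by
  rw [← image_mul_div_one_sub hr, integrableOn_image_iff_integrableOn_abs_deriv_smul
    measurableSet_Ioo (fun w hw => hasDerivWithinAt_mul_div_one_sub r hw)
    (injOn_mul_div_one_sub hr)]
  refine IntegrableOn.congr_fun ?_ (fun w hw => (mul_div_one_sub_smul hr a b hw).symm)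
    measurableSet_Ioo
  exact Integrable.const_mul
    (intervalIntegrable_iff_Ioo.1 (Complex.betaIntegral_convergent ha hb)) _

/-- The Beta integral over the half line. -/
lemma integral_Ioi_cpow_mul_add_cpow {a b : ℂ} (ha : 0 < a.re) (hb : 0 < b.re) {r : ℝ}
    (hr : 0 < r) :
    ∫ x in Ioi (0 : ℝ), (x : ℂ) ^ (a - 1) * ((x + r : ℝ) : ℂ) ^ (-(a + b)) =
      (r : ℂ) ^ (-b) * (Complex.Gamma a * Complex.Gamma b / Complex.Gamma (a + b)) := by
  rw [← Complex.betaIntegral_eq_Gamma_mul_div a b ha hb]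
  conv_lhs => rw [← image_mul_div_one_sub hr]
  rw [integral_image_eq_integral_abs_deriv_smul
    measurableSet_Ioo (fun w hw => hasDerivWithinAt_mul_div_one_sub r hw)
    (injOn_mul_div_one_sub hr)]
  rw [setIntegral_congr_fun measurableSet_Ioo (fun w hw => mul_div_one_sub_smul hr a b hw),
    integral_const_mul, Complex.betaIntegral, intervalIntegral.integral_of_le zero_le_one,
    integral_Ioc_eq_integral_Ioo]

/-! ### The Mellin transform of the saturated exponential -/

/-- `1 - exp (-κ x / (x + r))`. -/
noncomputable def satExp (κ r x : ℝ) : ℝ := 1 - Real.exp (-(κ * (x / (x + r))))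

lemma cpow_mul_satRatio_cpow {κ r x : ℝ} (hκ : 0 < κ) (hr : 0 < r) (hx : 0 < x) (z s : ℂ) :
    (x : ℂ) ^ (-(z + 1)) * ((κ * (x / (x + r)) : ℝ) : ℂ) ^ (-s) =
      (κ : ℂ) ^ (-s) * ((x : ℂ) ^ (-z - s - 1) * ((x + r : ℝ) : ℂ) ^ (-(-z - s + z))) := by
  rw [ofReal_cpow_eq_exp hx, ofReal_cpow_eq_exp (by positivity), ofReal_cpow_eq_exp hκ,
    ofReal_cpow_eq_exp hx, ofReal_cpow_eq_exp (by positivity), ← Complex.exp_add,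
    ← Complex.exp_add, ← Complex.exp_add, Real.log_mul hκ.ne' (by positivity),
    Real.log_div hx.ne' (by positivity)]
  congr 1
  push_cast
  ring

/-- This is Γ(1-s) = -sΓ(-s), which merges the 1/(-s) of the Mellin transform with the 1/Γ(-s) of
the Beta integral. -/
lemma Gamma_one_add_div_neg_mul {z s : ℂ} (hs : s ≠ 0) (hs' : Complex.Gamma (-s) ≠ 0) :
    Complex.Gamma (1 + s) / -s *
      (Complex.Gamma (-z - s) * Complex.Gamma z / Complex.Gamma (-z - s + z)) =
    Complex.Gamma (-z - s) * Complex.Gamma z *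
      (Complex.Gamma (1 + s) / Complex.Gamma (1 - s)) := by
  have h1 : -z - s + z = -s := by ring
  have h2 := Complex.Gamma_add_one (-s) (neg_ne_zero.2 hs)
  have h3 : 1 - s = -s + 1 := by ring
  rw [h1, h3, h2]
  have : -s ≠ 0 := neg_ne_zero.2 hs
  field_simp

/-- Insert the contour integral of 1 - exp(-t) at t = κx/(x+r), interchange, and evaluate the
x-integral as a Beta integral with a = -v-s and b = v. -/
lemma integral_cpow_mul_satExp {c d κ r : ℝ} (hc : 0 < c) (hd : -1 < d) (hcd : c + d < 0)
    (hκ : 0 < κ) (hr : 0 < r) (y : ℝ) :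
    ∫ x in Ioi (0 : ℝ), (x : ℂ) ^ (-linePt (c + 1) y) * (satExp κ r x : ℂ) =
      (1 / (2 * (Real.pi : ℂ))) * ((r : ℂ) ^ (-linePt c y) *
        ∫ u : ℝ, Complex.Gamma (-linePt c y - linePt d u) * Complex.Gamma (linePt c y) *
          (Complex.Gamma (1 + linePt d u) / Complex.Gamma (1 - linePt d u)) *
          (κ : ℂ) ^ (-linePt d u)) := by
  have hd0 : d < 0 := by linarith
  set z := linePt c y with hz
  have hexp : ∀ x ∈ Ioi (0 : ℝ), (x : ℂ) ^ (-linePt (c + 1) y) * (satExp κ r x : ℂ) =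
      ∫ u : ℝ, (1 / (2 * (Real.pi : ℂ))) * (Complex.Gamma (1 + linePt d u) / -linePt d u *
        ((κ : ℂ) ^ (-linePt d u) * ((x : ℂ) ^ (-z - linePt d u - 1) *
          ((x + r : ℝ) : ℂ) ^ (-(-z - linePt d u + z))))) := by
    intro x hx
    have hx : 0 < x := hx
    rw [satExp, one_sub_exp_neg_eq_integral hd hd0 (by positivity), ← linePt_add_one,
      ← mul_assoc, mul_comm _ (1 / _), mul_assoc, ← integral_const_mul, ← integral_const_mul]
    congr 1
    funext u
    rw [← cpow_mul_satRatio_cpow hκ hr hx]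
    ring
  rw [setIntegral_congr_fun measurableSet_Ioi hexp, integral_integral_swap]
  · rw [← integral_const_mul, ← integral_const_mul]
    congr 1
    funext u
    rw [integral_const_mul, integral_const_mul, integral_const_mul,
      integral_Ioi_cpow_mul_add_cpow (by simp [hz]; linarith) (by simpa [hz]) hr]
    have h1 := Gamma_one_add_div_neg_mul (z := z) (linePt_ne_zero hd0.ne u)
      (Complex.Gamma_ne_zero_of_re_pos (by simpa))
    rw [← h1]
    ring
  -- The moduli of the powers depend only on the abscissae, so the norm of the integrand is a
  -- product of a function of x and a function of u.
  · have h1 := integrable_Gamma_one_add_div_neg hd hd0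
    have h2 := integrableOn_Ioi_cpow_mul_add_cpow (a := ((-c - d : ℝ) : ℂ)) (b := (c : ℂ))
      (by simp; linarith) (by simpa) hr
    have h3 := (h2.norm.mul_prod h1.norm).const_mul (1 / (2 * Real.pi) * κ ^ (-d))
    refine h3.mono' ?_ ?_
    · have hG : AEStronglyMeasurable (fun p : ℝ × ℝ => Complex.Gamma (1 + linePt d p.2) /
          -linePt d p.2) ((volume.restrict (Ioi 0)).prod volume) :=
        h1.aestronglyMeasurable.comp_snd
      refine (hG.mul (Measurable.aestronglyMeasurable ?_)).const_mul _
      fun_prop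
    · have hmem : ∀ᵐ p : ℝ × ℝ ∂(volume.restrict (Ioi 0)).prod volume, 0 < p.1 :=
        Measure.quasiMeasurePreserving_fst.ae (ae_restrict_mem measurableSet_Ioi)
      filter_upwards [hmem] with p hp
      have e1 : -z - linePt d p.2 - 1 = linePt (-c - d - 1) (-(y + p.2)) := by
        simp only [hz, linePt]; push_cast; ring
      have e2 : -(-z - linePt d p.2 + z) = linePt d p.2 := by ring
      have e3 : (((-c - d : ℝ) : ℂ) - 1) = linePt (-c - d - 1) 0 := by
        simp only [linePt]; push_cast; ring
      have e4 : (-(((-c - d : ℝ) : ℂ) + c)) = linePt d 0 := by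
        simp only [linePt]; push_cast; ring
      simp only [norm_mul, Function.uncurry, e1, e2, e3, e4, norm_ofReal_cpow_linePt hp,
        norm_ofReal_cpow_linePt (add_pos hp hr), norm_ofReal_cpow_neg_linePt hκ]
      refine le_of_eq ?_
      simp [abs_of_pos Real.pi_pos]
      ring

/-! ### Log-normal smoothing and change of contour -/

section LogNormalSmoothing

open ProbabilityTheory

lemma integral_cexp_gaussian (w : ℂ) :
    ∫ z : ℝ, Complex.exp (w * z) ∂(gaussianReal 0 1) = Complex.exp (w ^ 2 / 2) := by
  have := complexMGF_id_gaussianReal (μ := 0) (v := 1) w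
  simpa [complexMGF] using this

/-- The real part of (sv)²/2 is s²(σ² - y²)/2: Gaussian decay along the line, bounded on strips. -/
lemma norm_cexp_mul_linePt_sq (s σ y : ℝ) :
    ‖Complex.exp ((s * linePt σ y) ^ 2 / 2)‖ =
      Real.exp (s ^ 2 * σ ^ 2 / 2) * Real.exp (-(s ^ 2 / 2) * y ^ 2) := by
  rw [Complex.norm_exp, ← Real.exp_add]
  congr 1
  have : ((s * linePt σ y) ^ 2 / 2 : ℂ) =
      ((s ^ 2 * σ ^ 2 / 2 + -(s ^ 2 / 2) * y ^ 2 : ℝ) : ℂ) + ((s ^ 2 * σ * y : ℝ) : ℂ) * Complex.I := by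
    simp only [linePt]; push_cast
    linear_combination (s ^ 2 * y ^ 2 / 2 : ℂ) * Complex.I_sq
  rw [this, Complex.add_re, Complex.ofReal_re, Complex.re_ofReal_mul, Complex.I_re, mul_zero,
    add_zero]

/-- The constant comes from (1+|y|)^k ≤ k! exp(1+|y|) and, completing the square, |y| ≤ ay² +
1/(4a). -/
lemma exists_pow_mul_exp_neg_sq_le (k : ℕ) {a : ℝ} (ha : 0 < a) :
    ∃ C, 0 ≤ C ∧ ∀ y : ℝ, (1 + |y|) ^ k * Real.exp (-a * y ^ 2) ≤ C := by
  refine ⟨k.factorial * Real.exp (1 + 1 / (4 * a)), by positivity, fun y => ?_⟩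
  have h1 := Real.pow_div_factorial_le_exp (1 + |y|) (by positivity) k
  rw [div_le_iff₀ (by positivity)] at h1
  calc _ ≤ Real.exp (1 + |y|) * k.factorial * Real.exp (-a * y ^ 2) := by gcongr
    _ = k.factorial * Real.exp (1 + |y| + -a * y ^ 2) := by rw [Real.exp_add (1 + |y|)]; ring
    _ ≤ _ := by
      refine mul_le_mul_of_nonneg_left (Real.exp_le_exp.2 ?_) (by positivity)
      have h2 : 0 ≤ a * (|y| - 1 / (2 * a)) ^ 2 := by positivity
      have h3 : a * (|y| - 1 / (2 * a)) ^ 2 = a * y ^ 2 - |y| + 1 / (4 * a) := by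
        rw [sub_sq, sq_abs]; field_simp; ring
      linarith

namespace FoxParams

variable {m n p q : ℕ} {F : FoxParams m n p q}

lemma exists_gaussian_kernel_bound (hA : ∀ i, 0 < F.A i) (hB : ∀ i, 0 < F.B i) {σ₁ σ₂ c : ℝ}
    (h₁ : F.Separates σ₁) (h₂ : F.Separates σ₂) (hc : c ∈ Icc σ₁ σ₂) (hconv : F.Converges c)
    {s : ℝ} (hs : s ≠ 0) :
    ∃ h : ℝ → ℝ, Integrable h ∧ ∀ σ ∈ Icc σ₁ σ₂, ∀ y,
      ‖F.kernel (linePt σ y) * Complex.exp ((s * linePt σ y) ^ 2 / 2)‖ ≤ h y := by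
  obtain ⟨k, g, hg, hb⟩ := exists_kernel_bound hA hB h₁ h₂ hc hconv
  obtain ⟨C, hC0, hC⟩ := exists_pow_mul_exp_neg_sq_le k (a := s ^ 2 / 2) (by positivity)
  refine ⟨fun y => Real.exp (s ^ 2 * (|σ₁| + |σ₂|) ^ 2 / 2) * C * g y, hg.const_mul _,
    fun σ hσ y => ?_⟩
  have h2 : 0 < (1 + |y|) ^ k := by positivity
  have h3 : 0 ≤ g y := nonneg_of_mul_nonneg_right ((norm_nonneg _).trans (hb σ hσ y)) h2
  have h4 : σ ^ 2 ≤ (|σ₁| + |σ₂|) ^ 2 := by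
    refine sq_le_sq.2 ?_
    rw [abs_of_nonneg (a := |σ₁| + |σ₂|) (by positivity), abs_le]
    constructor <;> linarith [hσ.1, hσ.2, neg_abs_le σ₁, le_abs_self σ₂, abs_nonneg σ₁,
      abs_nonneg σ₂]
  rw [norm_mul, norm_cexp_mul_linePt_sq]
  calc _ ≤ ((1 + |y|) ^ k * g y) *
        (Real.exp (s ^ 2 * (|σ₁| + |σ₂|) ^ 2 / 2) * Real.exp (-(s ^ 2 / 2) * y ^ 2)) := by
        gcongr
        exact hb σ hσ y
    _ = Real.exp (s ^ 2 * (|σ₁| + |σ₂|) ^ 2 / 2) *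
        ((1 + |y|) ^ k * Real.exp (-(s ^ 2 / 2) * y ^ 2)) * g y := by ring
    _ ≤ Real.exp (s ^ 2 * (|σ₁| + |σ₂|) ^ 2 / 2) * C * g y := by gcongr; exact hC y

lemma continuous_gaussian_kernel {σ : ℝ} (h : F.Separates σ) (s : ℝ) :
    Continuous fun y => F.kernel (linePt σ y) * Complex.exp ((s * linePt σ y) ^ 2 / 2) := by
  have := continuous_linePt σ
  exact (continuous_kernel_linePt h).mul (by fun_prop)

lemma integrable_gaussian_kernel (hA : ∀ i, 0 < F.A i) (hB : ∀ i, 0 < F.B i) {c₀ σ : ℝ}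
    (h₀ : F.Separates c₀) (hσ : F.Separates σ) (hconv : F.Converges c₀) {s : ℝ} (hs : s ≠ 0) :
    Integrable fun y => F.kernel (linePt σ y) * Complex.exp ((s * linePt σ y) ^ 2 / 2) := by
  have hsep : F.Separates (min c₀ σ) ∧ F.Separates (max c₀ σ) := by
    rcases le_total c₀ σ with h | h <;> simp [h, h₀, hσ]
  obtain ⟨h, hh, hb⟩ := exists_gaussian_kernel_bound hA hB hsep.1 hsep.2 (c := c₀) (by simp) hconv hs
  exact hh.mono' (continuous_gaussian_kernel hσ s).aestronglyMeasurable
    (ae_of_all _ (hb σ (by simp)))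

lemma integral_gaussian_kernel_shift (hA : ∀ i, 0 < F.A i) (hB : ∀ i, 0 < F.B i) {c₀ σ : ℝ}
    (h₀ : F.Separates c₀) (hσ : F.Separates σ) (hconv : F.Converges c₀) {s : ℝ} (hs : s ≠ 0)
    {x : ℝ} (hx : 0 < x) :
    ∫ y, F.kernel (linePt c₀ y) * Complex.exp ((s * linePt c₀ y) ^ 2 / 2) *
        (x : ℂ) ^ (-linePt c₀ y) =
      ∫ y, F.kernel (linePt σ y) * Complex.exp ((s * linePt σ y) ^ 2 / 2) *
        (x : ℂ) ^ (-linePt σ y) := by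
  have key : ∀ σ₁ σ₂, F.Separates σ₁ → F.Separates σ₂ → σ₁ ≤ σ₂ → c₀ ∈ Icc σ₁ σ₂ →
      ∫ y, F.kernel (linePt σ₁ y) * Complex.exp ((s * linePt σ₁ y) ^ 2 / 2) *
        (x : ℂ) ^ (-linePt σ₁ y) =
      ∫ y, F.kernel (linePt σ₂ y) * Complex.exp ((s * linePt σ₂ y) ^ 2 / 2) *
        (x : ℂ) ^ (-linePt σ₂ y) := by
    intro σ₁ σ₂ h₁ h₂ hle hc
    obtain ⟨h, hh, hb⟩ := exists_gaussian_kernel_bound hA hB h₁ h₂ hc hconv hs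
    obtain ⟨M, hM⟩ := (isCompact_Icc (a := σ₁) (b := σ₂)).exists_bound_of_continuousOn
      (f := fun σ : ℝ => x ^ (-σ))
      (Continuous.continuousOn (Real.continuous_const_rpow hx.ne' |>.comp continuous_neg))
    refine integral_linePt_eq_of_dominated (Φ := fun v => F.kernel v *
      Complex.exp ((s * v) ^ 2 / 2) * (x : ℂ) ^ (-v)) hle (fun v hv => ?_) (hh.mul_const M)
      fun σ hσ y => ?_
    · refine ((differentiableAt_kernel (h₁.of_mem_Icc h₂ hv)).mul (by fun_prop)).mul ?_
      exact DifferentiableAt.const_cpow (by fun_prop) (Or.inl (by exact_mod_cast hx.ne'))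
    · rw [norm_mul, norm_ofReal_cpow_neg_linePt hx]
      gcongr
      · exact (norm_nonneg _).trans (hb σ hσ y)
      · exact hb σ hσ y
      · exact (le_abs_self _).trans (hM σ hσ)
  rcases le_total c₀ σ with h | h
  · exact key _ _ h₀ hσ h (by simp [h])
  · exact (key _ _ hσ h₀ h (by simp [h])).symm

end FoxParams

lemma cpow_mul_exp_neg {x : ℝ} (hx : 0 < x) (t : ℝ) (v : ℂ) :
    ((x * Real.exp (-t) : ℝ) : ℂ) ^ (-v) = (x : ℂ) ^ (-v) * Complex.exp (v * t) := by
  rw [ofReal_cpow_eq_exp (by positivity), ofReal_cpow_eq_exp hx, ← Complex.exp_add,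
    Real.log_mul hx.ne' (Real.exp_pos _).ne', Real.log_exp]
  congr 1
  push_cast
  ring

section smoothing

variable {m n p q : ℕ} {F : FoxParams m n p q}

/-- On the line the power of x exp(-sz) has modulus x^(-c₀) exp(s c₀ z), which is
Gaussian-integrable, so the integrand splits into a product. -/
lemma integrable_foxH_smoothing {c₀ : ℝ} (h₀ : F.Separates c₀) (hconv : F.Converges c₀) (s : ℝ)
    {x : ℝ} (hx : 0 < x) :
    Integrable (fun p : ℝ × ℝ => F.kernel (linePt c₀ p.2) *
      ((x * Real.exp (-(s * p.1)) : ℝ) : ℂ) ^ (-linePt c₀ p.2)) ((gaussianReal 0 1).prod volume) := by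
  have h1 : Integrable (fun z : ℝ => x ^ (-c₀) * Real.exp (s * c₀ * z)) (gaussianReal 0 1) :=
    (integrable_exp_mul_gaussianReal _).const_mul _
  refine (h1.mul_prod hconv.norm).mono' ?_ (ae_of_all _ fun p => ?_)
  · have hK : Measurable fun y => F.kernel (linePt c₀ y) :=
      (FoxParams.continuous_kernel_linePt h₀).measurable
    exact ((hK.comp measurable_snd).mul (by fun_prop)).aestronglyMeasurable
  · rw [norm_mul, norm_ofReal_cpow_neg_linePt (by positivity), Real.mul_rpow hx.le (Real.exp_pos _).le,
      ← Real.exp_mul]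
    refine le_of_eq ?_
    rw [show -(s * p.1) * -c₀ = s * c₀ * p.1 by ring]
    ring

/-- Log-normal smoothing multiplies the kernel of a Fox H-function by a Gaussian factor; the
contour may then be moved to any other separating line. -/
lemma integral_foxH_gaussian (hA : ∀ i, 0 < F.A i) (hB : ∀ i, 0 < F.B i) {c₀ σ : ℝ}
    (h₀ : F.Separates c₀) (hσ : F.Separates σ) (hconv : F.Converges c₀) {s : ℝ} (hs : s ≠ 0)
    {x : ℝ} (hx : 0 < x) :
    ∫ z, foxH F c₀ (x * Real.exp (-(s * z))) ∂(gaussianReal 0 1) = (1 / (2 * (Real.pi : ℂ))) *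
      ∫ y, F.kernel (linePt σ y) * Complex.exp ((s * linePt σ y) ^ 2 / 2) *
        (x : ℂ) ^ (-linePt σ y) := by
  simp only [foxH]
  rw [integral_const_mul, integral_integral_swap (integrable_foxH_smoothing h₀ hconv s hx),
    ← FoxParams.integral_gaussian_kernel_shift hA hB h₀ hσ hconv hs hx]
  congr 2
  funext y
  simp only [cpow_mul_exp_neg hx]
  rw [integral_const_mul, integral_const_mul, ← integral_cexp_gaussian]
  have : ∀ z : ℝ, linePt c₀ y * ((s * z : ℝ) : ℂ) = s * linePt c₀ y * z := fun z => by
    push_cast; ring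
  simp only [this]
  ring

lemma integrable_foxH_comp_gaussian {c₀ : ℝ} (h₀ : F.Separates c₀) (hconv : F.Converges c₀) (s : ℝ)
    {x : ℝ} (hx : 0 < x) :
    Integrable (fun z => foxH F c₀ (x * Real.exp (-(s * z)))) (gaussianReal 0 1) := by
  simp only [foxH]
  exact ((integrable_foxH_smoothing h₀ hconv s hx).integral_prod_left).const_mul _

lemma measurable_foxH {c₀ : ℝ} (h₀ : F.Separates c₀) : Measurable (foxH F c₀) := by
  unfold foxH
  refine Measurable.const_mul ?_ _
  have hK : Measurable fun y => F.kernel (linePt c₀ y) :=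
    (FoxParams.continuous_kernel_linePt h₀).measurable
  have : Measurable (Function.uncurry fun (x y : ℝ) =>
      F.kernel (linePt c₀ y) * (x : ℂ) ^ (-linePt c₀ y)) := by
    unfold Function.uncurry
    exact (hK.comp measurable_snd).mul (by fun_prop)
  exact this.stronglyMeasurable.integral_prod_right.measurable

end smoothing

lemma measurable_satExp (κ r : ℝ) : Measurable (satExp κ r) := by
  unfold satExp; fun_prop

lemma satExp_nonneg {κ r x : ℝ} (hκ : 0 ≤ κ) (hr : 0 < r) (hx : 0 ≤ x) : 0 ≤ satExp κ r x := by
  have : Real.exp (-(κ * (x / (x + r)))) ≤ 1 := Real.exp_le_one_iff.2 (by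
    have : 0 ≤ κ * (x / (x + r)) := by positivity
    linarith)
  unfold satExp; linarith

lemma satExp_le_one (κ r x : ℝ) : satExp κ r x ≤ 1 := by
  have := Real.exp_pos (-(κ * (x / (x + r))))
  unfold satExp; linarith

lemma satExp_le {κ r x : ℝ} : satExp κ r x ≤ κ * (x / (x + r)) := by
  have := Real.add_one_le_exp (-(κ * (x / (x + r))))
  unfold satExp; linarith

/-- The bound `satExp_le` reduces this to the real Beta integral with parameters 1 - c and c, whence
0 < c < 1. -/
lemma integrableOn_rpow_mul_satExp {c κ r : ℝ} (hc : 0 < c) (hc1 : c < 1) (hκ : 0 < κ)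
    (hr : 0 < r) : IntegrableOn (fun x : ℝ => x ^ (-(c + 1)) * satExp κ r x) (Ioi 0) := by
  have h := (integrableOn_Ioi_cpow_mul_add_cpow (a := ((1 - c : ℝ) : ℂ)) (b := (c : ℂ))
      (by simpa) (by simpa) hr).norm.const_mul κ
  refine h.mono' ((by fun_prop : Measurable fun x : ℝ => x ^ (-(c + 1))).mul
    (measurable_satExp κ r)).aestronglyMeasurable ?_
  filter_upwards [ae_restrict_mem measurableSet_Ioi] with x hx
  have hx : 0 < x := hx
  have h0 := satExp_nonneg hκ.le hr hx.le
  rw [Real.norm_of_nonneg (by positivity), norm_mul, Complex.norm_cpow_eq_rpow_re_of_pos hx,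
    Complex.norm_cpow_eq_rpow_re_of_pos (by positivity)]
  have e1 : (((1 - c : ℝ) : ℂ) - 1).re = -(c + 1) + 1 := by simp
  have e2 : (-(((1 - c : ℝ) : ℂ) + c)).re = -1 := by simp
  rw [e1, e2, Real.rpow_neg_one, Real.rpow_add_one hx.ne']
  calc _ ≤ x ^ (-(c + 1)) * (κ * (x / (x + r))) := by gcongr; exact satExp_le
    _ = _ := by ring

/-! ### Pairing a smoothed Fox H-function with the saturated exponential -/

section pairing

variable {m n p q : ℕ} {F : FoxParams m n p q}

lemma integrable_smoothing_mul_satExp (hA : ∀ i, 0 < F.A i) (hB : ∀ i, 0 < F.B i) {c₀ c κ r φ : ℝ}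
    (h₀ : F.Separates c₀) (hσ : F.Separates (c + 1)) (hconv : F.Converges c₀) (hc : 0 < c)
    (hc1 : c < 1) (hκ : 0 < κ) (hr : 0 < r) (hφ : 0 < φ) {s : ℝ} (hs : s ≠ 0) :
    Integrable (fun p : ℝ × ℝ => F.kernel (linePt (c + 1) p.2) *
        Complex.exp ((s * linePt (c + 1) p.2) ^ 2 / 2) * ((φ * p.1 : ℝ) : ℂ) ^ (-linePt (c + 1) p.2) *
        (satExp κ r p.1 : ℂ)) ((volume.restrict (Ioi 0)).prod volume) := by
  have h1 := FoxParams.integrable_gaussian_kernel hA hB h₀ hσ hconv hs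
  have h2 := (integrableOn_rpow_mul_satExp hc hc1 hκ hr).const_mul (φ ^ (-(c + 1)))
  refine (h2.mul_prod h1.norm).mono' ?_ ?_
  · have hK := (FoxParams.continuous_gaussian_kernel hσ s).measurable
    have hS := measurable_satExp κ r
    exact (((hK.comp measurable_snd).mul (by fun_prop)).mul
      (by fun_prop)).aestronglyMeasurable
  · have hmem : ∀ᵐ p : ℝ × ℝ ∂(volume.restrict (Ioi 0)).prod volume, 0 < p.1 :=
      Measure.quasiMeasurePreserving_fst.ae (ae_restrict_mem measurableSet_Ioi)
    filter_upwards [hmem] with p hp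
    have h0 := satExp_nonneg hκ.le hr hp.le
    rw [norm_mul, norm_mul, norm_ofReal_cpow_neg_linePt (by positivity), Complex.norm_real,
      Real.norm_of_nonneg h0, Real.mul_rpow hφ.le hp.le]
    refine le_of_eq ?_
    ring

/-- Parseval's formula for a smoothed Fox H-function against `satExp`. -/
lemma integral_smoothing_mul_satExp (hA : ∀ i, 0 < F.A i) (hB : ∀ i, 0 < F.B i)
    {c₀ c d κ r φ : ℝ} (h₀ : F.Separates c₀) (hσ : F.Separates (c + 1)) (hconv : F.Converges c₀)
    (hc : 0 < c) (hd : -1 < d) (hcd : c + d < 0) (hκ : 0 < κ) (hr : 0 < r) (hφ : 0 < φ) {s : ℝ}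
    (hs : s ≠ 0) :
    Integrable (fun x => (∫ z, foxH F c₀ (φ * x * Real.exp (-(s * z))) ∂(gaussianReal 0 1)) *
      (satExp κ r x : ℂ)) (volume.restrict (Ioi 0)) ∧
    ∫ x in Ioi (0 : ℝ), (∫ z, foxH F c₀ (φ * x * Real.exp (-(s * z))) ∂(gaussianReal 0 1)) *
      (satExp κ r x : ℂ) = (1 / (φ : ℂ)) * ((1 / (2 * (Real.pi : ℂ))) ^ 2 *
        ∫ w : ℝ × ℝ, foxH2Integrand asepCross F.shift asepSecond c d (φ * r) κ w *
          Complex.exp ((s * linePt (c + 1) w.1) ^ 2 / 2)) := by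
  have hI := integrable_smoothing_mul_satExp hA hB h₀ hσ hconv hc (by linarith) hκ hr hφ hs
  have e : ∀ x ∈ Ioi (0 : ℝ),
      (∫ z, foxH F c₀ (φ * x * Real.exp (-(s * z))) ∂(gaussianReal 0 1)) * (satExp κ r x : ℂ) =
      (1 / (2 * (Real.pi : ℂ))) * ∫ y, F.kernel (linePt (c + 1) y) *
        Complex.exp ((s * linePt (c + 1) y) ^ 2 / 2) * ((φ * x : ℝ) : ℂ) ^ (-linePt (c + 1) y) *
        (satExp κ r x : ℂ) := fun x hx => by
    rw [integral_foxH_gaussian hA hB h₀ hσ hconv hs (mul_pos hφ hx), mul_assoc, ← integral_mul_const]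
  constructor
  · exact IntegrableOn.congr_fun (hI.integral_prod_left.const_mul _) (fun x hx => (e x hx).symm)
      measurableSet_Ioi
  · rw [setIntegral_congr_fun measurableSet_Ioi e, integral_const_mul, integral_integral_swap hI,
      Measure.volume_eq_prod, integral_prod]
    · rw [sq, mul_assoc, mul_left_comm (1 / (φ : ℂ))]
      congr 1
      rw [← integral_const_mul, ← integral_const_mul]
      congr 1
      funext y
      have e1 : ∀ x ∈ Ioi (0 : ℝ), F.kernel (linePt (c + 1) y) *
          Complex.exp ((s * linePt (c + 1) y) ^ 2 / 2) *
          ((φ * x : ℝ) : ℂ) ^ (-linePt (c + 1) y) * (satExp κ r x : ℂ) =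
          F.kernel (linePt (c + 1) y) * Complex.exp ((s * linePt (c + 1) y) ^ 2 / 2) *
            (φ : ℂ) ^ (-linePt (c + 1) y) *
          ((x : ℂ) ^ (-linePt (c + 1) y) * (satExp κ r x : ℂ)) := fun x hx => by
        have hx : 0 < x := hx
        rw [Complex.ofReal_mul, Complex.mul_cpow_ofReal_nonneg hφ.le hx.le]
        ring
      rw [setIntegral_congr_fun measurableSet_Ioi e1, integral_const_mul,
        integral_cpow_mul_satExp hc hd hcd hκ hr]
      simp only [foxH2Integrand_asep]
      -- The kernel sits on the line c + 1 but the bivariate argument carries the exponent -v; the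
      -- surplus power of φ is the factor 1/φ of the final formula.
      have e2 : (φ : ℂ) ^ (-linePt (c + 1) y) = (φ : ℂ) ^ (-linePt c y) * (1 / φ) := by
        rw [← linePt_add_one, neg_add, Complex.cpow_add _ _ (by exact_mod_cast hφ.ne'),
          Complex.cpow_neg_one, one_div]
      have e3 : ((φ * r : ℝ) : ℂ) ^ (-linePt c y) =
          (φ : ℂ) ^ (-linePt c y) * (r : ℂ) ^ (-linePt c y) := by
        rw [Complex.ofReal_mul, Complex.mul_cpow_ofReal_nonneg hφ.le hr.le]
      have e4 : ∀ u : ℝ, Complex.Gamma (-linePt c y - linePt d u) *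
          (Complex.Gamma (linePt c y) * F.kernel (linePt (c + 1) y)) *
          (Complex.Gamma (1 + linePt d u) / Complex.Gamma (1 - linePt d u)) *
          ((φ * r : ℝ) : ℂ) ^ (-linePt c y) * (κ : ℂ) ^ (-linePt d u) *
          Complex.exp ((s * linePt (c + 1) y) ^ 2 / 2) =
          F.kernel (linePt (c + 1) y) * Complex.exp ((s * linePt (c + 1) y) ^ 2 / 2) *
          ((φ : ℂ) ^ (-linePt c y) * (r : ℂ) ^ (-linePt c y)) *
          (Complex.Gamma (-linePt c y - linePt d u) * Complex.Gamma (linePt c y) *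
          (Complex.Gamma (1 + linePt d u) / Complex.Gamma (1 - linePt d u)) *
          (κ : ℂ) ^ (-linePt d u)) := fun u => by rw [e3]; ring
      simp only [e4, integral_const_mul]
      rw [e2]
      ring
    · rw [← Measure.volume_eq_prod]
      refine (integrable_foxH2Integrand_asep hA hB h₀ hconv hc hσ hd hcd (by positivity) hκ).mul_bdd
        (c := Real.exp (s ^ 2 * (c + 1) ^ 2 / 2)) (Measurable.aestronglyMeasurable (by fun_prop))
        (ae_of_all _ fun w => ?_)
      rw [norm_cexp_mul_linePt_sq]
      exact mul_le_of_le_one_right (Real.exp_pos _).le (Real.exp_le_one_iff.2 (by nlinarith [sq_nonneg (s * w.2), sq_nonneg (s * w.1)]))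

/-- Removing the Gaussian factor. -/
lemma tendsto_integral_foxH2Integrand (hA : ∀ i, 0 < F.A i) (hB : ∀ i, 0 < F.B i)
    {c₀ c d x y : ℝ} (h₀ : F.Separates c₀) (hσ : F.Separates (c + 1)) (hconv : F.Converges c₀)
    (hc : 0 < c) (hd : -1 < d) (hcd : c + d < 0) (hx : 0 < x) (hy : 0 < y) :
    Tendsto (fun s : ℝ => ∫ w : ℝ × ℝ, foxH2Integrand asepCross F.shift asepSecond c d x y w *
          Complex.exp ((s * linePt (c + 1) w.1) ^ 2 / 2)) (𝓝[>] 0)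
      (𝓝 (∫ w : ℝ × ℝ, foxH2Integrand asepCross F.shift asepSecond c d x y w)) := by
  have hI := integrable_foxH2Integrand_asep hA hB h₀ hconv hc hσ hd hcd hx hy
  refine tendsto_integral_filter_of_dominated_convergence (fun w =>
    ‖foxH2Integrand asepCross F.shift asepSecond c d x y w‖ * Real.exp ((c + 1) ^ 2 / 2))
    (Eventually.of_forall fun s => hI.aestronglyMeasurable.mul
      (Measurable.aestronglyMeasurable (by fun_prop))) ?_ (hI.norm.mul_const _)
    (ae_of_all _ fun w => ?_)
  · filter_upwards [Ioo_mem_nhdsGT (zero_lt_one (α := ℝ))] with s hs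
    refine ae_of_all _ fun w => ?_
    rw [norm_mul, norm_cexp_mul_linePt_sq]
    gcongr
    rw [← Real.exp_add]
    gcongr
    have h1 : s ^ 2 ≤ 1 := by nlinarith [hs.1, hs.2]
    nlinarith [sq_nonneg (s * w.1), sq_nonneg (c + 1)]
  · have : Continuous fun s : ℝ => foxH2Integrand asepCross F.shift asepSecond c d x y w *
          Complex.exp ((s * linePt (c + 1) w.1) ^ 2 / 2) := by fun_prop
    have h2 := (this.tendsto 0).mono_left (nhdsWithin_le_nhds (s := Ioi 0))
    simpa using h2

end pairing

/-! ### Weak convergence of the log-normal smoothing -/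

section lognormal

variable {f g : ℝ → ℝ}

lemma integrable_exp_abs_gaussian : Integrable (fun z : ℝ => Real.exp |z|) (gaussianReal 0 1) := by
  have h1 : Integrable (fun z : ℝ => Real.exp (1 * z)) (gaussianReal 0 1) :=
    integrable_exp_mul_gaussianReal 1
  have h2 : Integrable (fun z : ℝ => Real.exp (-1 * z)) (gaussianReal 0 1) :=
    integrable_exp_mul_gaussianReal (-1)
  refine (h1.add h2).mono' (Measurable.aestronglyMeasurable (by fun_prop)) (ae_of_all _ fun z => ?_)
  rw [Real.norm_of_nonneg (Real.exp_pos _).le]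
  simp only [Pi.add_apply, one_mul, neg_mul]
  rcases abs_cases z with h | h <;> rw [h.1] <;> linarith [Real.exp_pos z, Real.exp_pos (-z)]

/-- Moves the dilation from f, which is only integrable, to the bounded continuous test function,
where the limit can be taken pointwise. -/
lemma setIntegral_Ioi_comp_mul_exp_neg (t : ℝ) :
    ∫ x in Ioi (0 : ℝ), f (x * Real.exp (-t)) * g x =
      ∫ x in Ioi (0 : ℝ), Real.exp t * (f x * g (x * Real.exp t)) := by
  have h := integral_comp_mul_right_Ioi (fun x => f x * g (x * Real.exp t)) 0 (Real.exp_pos (-t))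
  simp only [mul_assoc, ← Real.exp_add, neg_add_cancel, Real.exp_zero, mul_one, zero_mul] at h
  rw [h, integral_const_mul, ← Real.exp_neg, neg_neg, smul_eq_mul]

lemma integrable_lognormal (hf : Measurable f) (hfi : IntegrableOn f (Ioi 0)) (hg : Measurable g)
    (hg1 : ∀ x, 0 < x → |g x| ≤ 1) (s : ℝ) :
    Integrable (fun p : ℝ × ℝ => f (p.1 * Real.exp (-(s * p.2))) * g p.1)
      ((volume.restrict (Ioi 0)).prod (gaussianReal 0 1)) := by
  have hm : AEStronglyMeasurable (fun p : ℝ × ℝ => f (p.1 * Real.exp (-(s * p.2))) * g p.1)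
      ((volume.restrict (Ioi 0)).prod (gaussianReal 0 1)) := by
    refine Measurable.aestronglyMeasurable ?_
    fun_prop
  have hfi' : ∀ z : ℝ, IntegrableOn (fun x => f (x * Real.exp (-(s * z)))) (Ioi 0) := fun z => by
    rw [integrableOn_Ioi_comp_mul_right_iff f 0 (Real.exp_pos _), zero_mul]
    exact hfi
  have hint : ∀ z : ℝ, Integrable (fun x => f (x * Real.exp (-(s * z))) * g x)
      (volume.restrict (Ioi 0)) := fun z => by
    refine (hfi' z).mul_bdd (c := 1) hg.aestronglyMeasurable ?_
    filter_upwards [ae_restrict_mem measurableSet_Ioi] with x hx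
    exact hg1 x hx
  rw [integrable_prod_iff' hm]
  refine ⟨ae_of_all _ hint, ?_⟩
  have h1 : Integrable (fun z : ℝ => Real.exp (s * z) * ∫ x in Ioi 0, ‖f x‖) (gaussianReal 0 1) :=
    (integrable_exp_mul_gaussianReal s).mul_const _
  refine h1.mono' hm.norm.prod_swap.integral_prod_right' (ae_of_all _ fun z => ?_)
  rw [Real.norm_of_nonneg (integral_nonneg fun _ => norm_nonneg _)]
  have h2 := integral_comp_mul_right_Ioi (fun x => ‖f x‖) 0 (Real.exp_pos (-(s * z)))
  rw [zero_mul, ← Real.exp_neg, neg_neg, smul_eq_mul] at h2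
  rw [← h2]
  refine setIntegral_mono_on (hint z).norm (hfi' z).norm measurableSet_Ioi fun x hx => ?_
  rw [norm_mul]
  exact mul_le_of_le_one_right (norm_nonneg _) (hg1 x hx)

/-- Log-normal smoothing of an integrable density converges weakly as the variance tends to `0`. -/
lemma tendsto_integral_lognormal (hf : Measurable f) (hfi : IntegrableOn f (Ioi 0))
    (hg : Measurable g) (hgc : ContinuousOn g (Ioi 0)) (hg1 : ∀ x, 0 < x → |g x| ≤ 1) :
    Tendsto (fun s : ℝ => ∫ x in Ioi (0 : ℝ),
        (∫ z, f (x * Real.exp (-(s * z))) ∂(gaussianReal 0 1)) * g x) (𝓝[>] 0)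
      (𝓝 (∫ x in Ioi (0 : ℝ), f x * g x)) := by
  have hmem : ∀ᵐ p : ℝ × ℝ ∂(gaussianReal 0 1).prod (volume.restrict (Ioi 0)), 0 < p.2 :=
    Measure.quasiMeasurePreserving_snd.ae (ae_restrict_mem measurableSet_Ioi)
  have hbound : ∀ s ∈ Ioo (0 : ℝ) 1, ∀ z x : ℝ, 0 < x →
      ‖Real.exp (s * z) * (f x * g (x * Real.exp (s * z)))‖ ≤ Real.exp |z| * ‖f x‖ := by
    intro s hs z x hx
    rw [norm_mul, norm_mul, Real.norm_of_nonneg (Real.exp_pos _).le]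
    have h1 : s * z ≤ |z| := by
      calc s * z ≤ |s * z| := le_abs_self _
        _ = s * |z| := by rw [abs_mul, abs_of_pos hs.1]
        _ ≤ 1 * |z| := by gcongr; exact hs.2.le
        _ = |z| := one_mul _
    gcongr
    exact mul_le_of_le_one_right (norm_nonneg _) (hg1 _ (by positivity))
  have hdom := integrable_exp_abs_gaussian.mul_prod hfi.norm
  have hmeas : ∀ s : ℝ, AEStronglyMeasurable
      (fun p : ℝ × ℝ => Real.exp (s * p.1) * (f p.2 * g (p.2 * Real.exp (s * p.1))))
      ((gaussianReal 0 1).prod (volume.restrict (Ioi 0))) := fun s =>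
    Measurable.aestronglyMeasurable (by fun_prop)
  have heq : ∀ s ∈ Ioo (0 : ℝ) 1, ∫ x in Ioi (0 : ℝ),
        (∫ z, f (x * Real.exp (-(s * z))) ∂(gaussianReal 0 1)) * g x =
      ∫ p, Real.exp (s * p.1) * (f p.2 * g (p.2 * Real.exp (s * p.1)))
        ∂(gaussianReal 0 1).prod (volume.restrict (Ioi 0)) := by
    intro s hs
    rw [integral_prod]
    · simp only [← integral_mul_const]
      rw [integral_integral_swap (integrable_lognormal hf hfi hg hg1 s)]
      simp only [setIntegral_Ioi_comp_mul_exp_neg]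
    · refine hdom.mono' (hmeas s) ?_
      filter_upwards [hmem] with p hp using hbound s hs p.1 p.2 hp
  have hlim : ∫ x in Ioi (0 : ℝ), f x * g x =
      ∫ p, f p.2 * g p.2 ∂(gaussianReal 0 1).prod (volume.restrict (Ioi 0)) := by
    have h := integral_prod_mul (μ := gaussianReal 0 1) (ν := volume.restrict (Ioi 0))
      (fun _ => (1 : ℝ)) (fun x => f x * g x)
    simpa using h.symm
  rw [hlim]
  refine Tendsto.congr' (f₁ := fun s : ℝ => ∫ p : ℝ × ℝ, Real.exp (s * p.1) *
    (f p.2 * g (p.2 * Real.exp (s * p.1))) ∂(gaussianReal 0 1).prod (volume.restrict (Ioi 0))) ?_ ?_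
  · filter_upwards [Ioo_mem_nhdsGT (zero_lt_one (α := ℝ))] with s hs using (heq s hs).symm
  · refine tendsto_integral_filter_of_dominated_convergence _ (Eventually.of_forall hmeas) ?_ hdom ?_
    · filter_upwards [Ioo_mem_nhdsGT (zero_lt_one (α := ℝ))] with s hs
      filter_upwards [hmem] with p hp using hbound s hs p.1 p.2 hp
    · filter_upwards [hmem] with p hp
      have h1 : Tendsto (fun s : ℝ => Real.exp (s * p.1)) (𝓝[>] 0) (𝓝 1) := by
        have : Continuous fun s : ℝ => Real.exp (s * p.1) := by fun_prop
        simpa using (this.tendsto 0).mono_left (nhdsWithin_le_nhds (s := Ioi 0))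
      have h2 : Tendsto (fun s : ℝ => g (p.2 * Real.exp (s * p.1))) (𝓝[>] 0) (𝓝 (g p.2)) := by
        have h3 : ContinuousAt g p.2 := hgc.continuousAt (Ioi_mem_nhds hp)
        have h4 : Tendsto (fun s : ℝ => p.2 * Real.exp (s * p.1)) (𝓝[>] 0) (𝓝 p.2) := by
          simpa using h1.const_mul p.2
        exact h3.tendsto.comp h4
      simpa using h1.mul (h2.const_mul (f p.2))

end lognormal

lemma continuousOn_satExp (κ : ℝ) {r : ℝ} (hr : 0 < r) : ContinuousOn (satExp κ r) (Ioi 0) := by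
  unfold satExp
  refine continuousOn_const.sub (Real.continuous_exp.comp_continuousOn
    (ContinuousOn.neg (continuousOn_const.mul (continuousOn_id.div (by fun_prop) fun x hx => ?_))))
  have hx : 0 < x := hx
  exact (add_pos hx hr).ne'

/-- The `satExp` average of a density that is a finite sum of Fox H-functions. -/
lemma integral_foxH_sum_mul_satExp {L m n p q : ℕ} (ψ φ : Fin L → ℝ)
    (F : Fin L → FoxParams m n p q) (c₀ : Fin L → ℝ) (hφ : ∀ l, 0 < φ l)
    (hA : ∀ l i, 0 < (F l).A i) (hB : ∀ l i, 0 < (F l).B i)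
    (hsep : ∀ l, (F l).Separates (c₀ l)) (hconv : ∀ l, (F l).Converges (c₀ l))
    {f : ℝ → ℝ} (hfm : Measurable f) (hfi : IntegrableOn f (Ioi 0))
    (hf : ∀ x, 0 < x → (f x : ℂ) = ∑ l, (ψ l : ℂ) * foxH (F l) (c₀ l) (φ l * x))
    {c d : Fin L → ℝ} (hc : ∀ l, 0 < c l) (hσ : ∀ l, (F l).Separates (c l + 1))
    (hd : ∀ l, -1 < d l) (hcd : ∀ l, c l + d l < 0) {κ r : ℝ} (hκ : 0 < κ) (hr : 0 < r) :
    ((∫ x in Ioi (0 : ℝ), f x * satExp κ r x : ℝ) : ℂ) =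
      ∑ l, ((ψ l / φ l : ℝ) : ℂ) *
        foxH2 asepCross (F l).shift asepSecond (c l) (d l) (φ l * r) κ := by
  have h1 := tendsto_integral_lognormal hfm hfi (measurable_satExp κ r)
    (continuousOn_satExp κ hr) (fun x hx => by
      rw [abs_of_nonneg (satExp_nonneg hκ.le hr hx.le)]; exact satExp_le_one κ r x)
  have h1' := (Complex.continuous_ofReal.tendsto _).comp h1
  have h2 : Tendsto (fun s : ℝ => ∑ l, (ψ l : ℂ) * ((1 / (φ l : ℂ)) *
      ((1 / (2 * (Real.pi : ℂ))) ^ 2 *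
        ∫ w : ℝ × ℝ, foxH2Integrand asepCross (F l).shift asepSecond (c l) (d l) (φ l * r) κ w *
          Complex.exp ((s * linePt (c l + 1) w.1) ^ 2 / 2)))) (𝓝[>] 0)
      (𝓝 (∑ l, (ψ l : ℂ) * ((1 / (φ l : ℂ)) * ((1 / (2 * (Real.pi : ℂ))) ^ 2 *
        ∫ w : ℝ × ℝ, foxH2Integrand asepCross (F l).shift asepSecond (c l) (d l) (φ l * r) κ w)))) :=
    tendsto_finsetSum _ fun l _ => ((((tendsto_integral_foxH2Integrand (hA l) (hB l) (hsep l)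
      (hσ l) (hconv l) (hc l) (hd l) (hcd l) (mul_pos (hφ l) hr) hκ).const_mul _).const_mul
      _).const_mul _)
  have h3 : ∑ l, ((ψ l / φ l : ℝ) : ℂ) *
        foxH2 asepCross (F l).shift asepSecond (c l) (d l) (φ l * r) κ =
      ∑ l, (ψ l : ℂ) * ((1 / (φ l : ℂ)) * ((1 / (2 * (Real.pi : ℂ))) ^ 2 *
        ∫ w : ℝ × ℝ, foxH2Integrand asepCross (F l).shift asepSecond (c l) (d l) (φ l * r) κ w)) := by
    refine Finset.sum_congr rfl fun l _ => ?_
    rw [foxH2]; push_cast; ring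
  rw [h3]
  -- Both sides are limits, as s → 0+, of the same smoothed pairing, evaluated directly and by
  -- Parseval.
  refine tendsto_nhds_unique h1' (h2.congr' ?_)
  filter_upwards [self_mem_nhdsWithin] with s hs
  have hs : s ≠ 0 := ne_of_gt hs
  have hpar := fun l => integral_smoothing_mul_satExp (hA l) (hB l) (hsep l) (hσ l) (hconv l) (hc l)
    (hd l) (hcd l) hκ hr (hφ l) hs
  have hcast : ∀ x ∈ Ioi (0 : ℝ), (((∫ z, f (x * Real.exp (-(s * z))) ∂(gaussianReal 0 1)) *
      satExp κ r x : ℝ) : ℂ) = ∑ l, (ψ l : ℂ) * ((∫ z, foxH (F l) (c₀ l)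
        (φ l * x * Real.exp (-(s * z))) ∂(gaussianReal 0 1)) * (satExp κ r x : ℂ)) := by
    intro x hx
    have hx : 0 < x := hx
    rw [Complex.ofReal_mul, ← integral_complex_ofReal]
    have : ∀ z : ℝ, ((f (x * Real.exp (-(s * z))) : ℝ) : ℂ) =
        ∑ l, (ψ l : ℂ) * foxH (F l) (c₀ l) (φ l * x * Real.exp (-(s * z))) := fun z => by
      rw [hf _ (by positivity)]; simp only [mul_assoc]
    simp only [this]
    rw [integral_finsetSum _ fun l _ => (integrable_foxH_comp_gaussian (hsep l) (hconv l) s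
      (mul_pos (hφ l) hx)).const_mul _, Finset.sum_mul]
    simp only [integral_const_mul, mul_assoc]
  simp only [Function.comp]
  rw [← integral_complex_ofReal, setIntegral_congr_fun measurableSet_Ioi hcast,
    integral_finsetSum _ fun l _ => (hpar l).1.const_mul _]
  simp only [integral_const_mul]
  exact Finset.sum_congr rfl fun l _ => by rw [(hpar l).2]

end LogNormalSmoothing

/-! ### The trapezoidal rule for the symbol error probability -/

/-- `exp (-δ γ)` for a rate `δ ∈ [0, ∞]`, with the value `0` at `δ = ∞`. -/
noncomputable def expRate (δ : ℝ≥0∞) (γ : ℝ) : ℝ :=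
  if δ = ⊤ then 0 else Real.exp (-(δ.toReal * γ))

lemma trapezoid_eq_sum (g : ℝ → ℝ) (b : ℝ) {N : ℕ} (hN : 1 ≤ N) :
    trapezoid g b N = ∑ k ∈ Finset.range (N + 1),
      b / N * (if k = 0 ∨ k = N then 1 / 2 else 1) * g (k * (b / N)) := by
  have hN0 : (N : ℝ) ≠ 0 := by positivity
  rw [Finset.sum_range_succ, Finset.range_eq_Ico, Finset.sum_eq_sum_Ico_succ_bot (by omega),
    Finset.sum_congr rfl (g := fun k : ℕ => b / N * g (k * (b / N))) (fun k hk => by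
      have := Finset.mem_Ico.1 hk
      rw [if_neg (by omega), mul_one]), ← Finset.mul_sum, trapezoid]
  simp only [true_or, or_true, if_true, Nat.cast_zero, zero_mul, zero_add]
  rw [mul_div_cancel₀ _ hN0]
  ring

/-- At a zero of the sine the rate is c₁/0 = ∞ in `ℝ≥0∞`, so both conventions give 0. -/
lemma ite_sin_eq_expRate {c₁ c₂ : ℝ} (h₁ : 0 < c₁) (h₂ : 0 < c₂) (t γ : ℝ) :
    (if Real.sin t = 0 then 0 else Real.exp (-(c₁ / c₂ * γ / Real.sin t ^ 2))) =
      expRate (ENNReal.ofReal c₁ / ENNReal.ofReal (c₂ * Real.sin t ^ 2)) γ := by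
  unfold expRate
  by_cases h : Real.sin t = 0
  · simp [h, h₁, ENNReal.div_zero]
  · have hs : 0 < c₂ * Real.sin t ^ 2 := by positivity
    rw [if_neg h, ← ENNReal.ofReal_div_of_pos hs, if_neg ENNReal.ofReal_ne_top,
      ENNReal.toReal_ofReal (by positivity)]
    congr 1
    field_simp

lemma exp_eq_expRate {c e : ℝ} (hc : 0 ≤ c) (he : 0 < e) (γ : ℝ) :
    Real.exp (-(c * γ / e)) = expRate (ENNReal.ofReal (c / e)) γ := by
  rw [expRate, if_neg ENNReal.ofReal_ne_top, ENNReal.toReal_ofReal (by positivity)]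
  congr 1
  ring

lemma sin_pi_div_pos {M : ℕ} (hM : 2 ≤ M) : 0 < Real.sin (Real.pi / M) := by
  have hM' : (2 : ℝ) ≤ M := by exact_mod_cast hM
  refine Real.sin_pos_of_pos_of_lt_pi (by positivity) ?_
  rw [div_lt_iff₀ (by positivity)]
  nlinarith [Real.pi_pos]

lemma cos_pi_div_mem {M : ℕ} (hM : 2 ≤ M) : Real.cos (Real.pi / M) ∈ Ico 0 1 := by
  have hM' : (2 : ℝ) ≤ M := by exact_mod_cast hM
  have h1 : Real.pi / M ≤ Real.pi / 2 := by gcongr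
  have h0 : 0 < Real.pi / M := by positivity
  refine ⟨Real.cos_nonneg_of_mem_Icc ⟨by linarith [Real.pi_pos], h1⟩, ?_⟩
  rw [← Real.cos_zero]
  exact Real.cos_lt_cos_of_nonneg_of_le_pi_div_two le_rfl h1 h0

lemma one_add_mul_cos_pos {d : ℝ} (hd : |d| < 1) (t : ℝ) : 0 < 1 + d * Real.cos t := by
  have h1 : |d * Real.cos t| < 1 := by
    rw [abs_mul]
    exact (mul_le_of_le_one_right (abs_nonneg _) (Real.abs_cos_le_one t)).trans_lt hd
  linarith [(abs_lt.1 h1).1]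

lemma abs_neg_inv_sqrt_two_lt : |(-(1 / √2) : ℝ)| < 1 := by
  rw [abs_neg, abs_of_pos (by positivity), div_lt_one (by positivity)]
  exact Real.lt_sqrt_of_sq_lt (by norm_num)

lemma sepTrapezoid_psk {M N : ℕ} (hM : 2 ≤ M) (hN : 1 ≤ N) (γ : ℝ) :
    sepTrapezoid (.psk M) N γ = ∑ k ∈ Finset.range (N + 1),
      sepTheta (.psk M) N k * expRate (sepDelta (.psk M) N k) γ := by
  have hM0 : (M : ℝ) ≠ 0 := by positivity
  have hN0 : (N : ℝ) ≠ 0 := by positivity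
  have hpi := Real.pi_ne_zero
  rw [sepTrapezoid, trapD, trapezoid_eq_sum _ _ hN, Finset.mul_sum]
  refine Finset.sum_congr rfl fun k _ => ?_
  have h := ite_sin_eq_expRate (c₂ := 1) (pow_pos (sin_pi_div_pos hM) 2) one_pos
    (k * ((M - 1) / M * Real.pi / N)) γ
  rw [div_one, one_mul] at h
  simp only [h, sepTheta, sepDelta]
  rw [show (k : ℝ) * ((M - 1) / M * Real.pi / N) = k * (M - 1) * Real.pi / (N * M) by
    field_simp, ← mul_assoc]
  congr 1
  split_ifs <;> field_simp

lemma sepTrapezoid_dpsk {M N : ℕ} (hM : 2 ≤ M) (hN : 1 ≤ N) (γ : ℝ) :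
    sepTrapezoid (.dpsk M) N γ = ∑ k ∈ Finset.range (N + 1),
      sepTheta (.dpsk M) N k * expRate (sepDelta (.dpsk M) N k) γ := by
  have hM0 : (M : ℝ) ≠ 0 := by positivity
  have hN0 : (N : ℝ) ≠ 0 := by positivity
  have hpi := Real.pi_ne_zero
  rw [sepTrapezoid, trapE, trapezoid_eq_sum _ _ hN, Finset.mul_sum]
  refine Finset.sum_congr rfl fun k _ => ?_
  have hc := cos_pi_div_mem hM
  rw [exp_eq_expRate (sq_nonneg _)
    (one_add_mul_cos_pos (by rw [abs_of_nonneg hc.1]; exact hc.2) _), sepTheta, sepDelta]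
  rw [show (k : ℝ) * ((M - 1) / M * Real.pi / N) = k * (M - 1) * Real.pi / (N * M) by
    field_simp, ← mul_assoc]
  congr 1
  split_ifs <;> field_simp

lemma sepTrapezoid_gcdqpsk {N : ℕ} (hN : 1 ≤ N) (γ : ℝ) :
    sepTrapezoid .gcdqpsk N γ = ∑ k ∈ Finset.range (N + 1),
      sepTheta .gcdqpsk N k * expRate (sepDelta .gcdqpsk N k) γ := by
  have hN0 : (N : ℝ) ≠ 0 := by positivity
  have hpi := Real.pi_ne_zero
  rw [sepTrapezoid, trapE, trapezoid_eq_sum _ _ hN, Finset.mul_sum]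
  refine Finset.sum_congr rfl fun k _ => ?_
  rw [exp_eq_expRate zero_le_one (one_add_mul_cos_pos abs_neg_inv_sqrt_two_lt _), sepTheta, sepDelta]
  rw [show (k : ℝ) * (1 * Real.pi / N) = k * Real.pi / N by ring, ← mul_assoc, neg_mul,
    ← sub_eq_add_neg]
  congr 1
  split_ifs
  · field_simp
    norm_num
  · field_simp

lemma sepTrapezoid_qam {M N : ℕ} (hM : 2 ≤ M) (hN : 1 ≤ N) (hN2 : Even N) (γ : ℝ) :
    sepTrapezoid (.qam M) N γ = ∑ k ∈ Finset.range (N + 1),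
      sepTheta (.qam M) N k * expRate (sepDelta (.qam M) N k) γ := by
  obtain ⟨K, rfl⟩ := hN2
  have hK : 1 ≤ K := by omega
  have hdiv : (K + K) / 2 = K := by omega
  have hM' : (2 : ℝ) ≤ M := by exact_mod_cast hM
  have hM1 : 0 < 2 * ((M : ℝ) - 1) := by linarith
  have hK0 : (K : ℝ) ≠ 0 := by positivity
  have hpi := Real.pi_ne_zero
  obtain ⟨r, hr, hrM⟩ : ∃ r : ℝ, 0 < r ∧ (M : ℝ) = r ^ 2 :=
    ⟨√M, by positivity, (Real.sq_sqrt (by positivity)).symm⟩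
  have hsqrt : √(M : ℝ) = r := by rw [hrM, Real.sqrt_sq hr.le]
  rw [sepTrapezoid, trapD, trapD, trapezoid_eq_sum _ _ hN, hdiv, trapezoid_eq_sum _ _ hK]
  -- Both rules have step π/(2N), so the K + 1 nodes of the second integral are the first nodes of
  -- the first. Extending the second sum by zero allows the weights to be compared node by node.
  have hrange : Finset.range (K + 1) = (Finset.range (K + K + 1)).filter (· < K + 1) := by
    ext k; simp only [Finset.mem_range, Finset.mem_filter]; omega
  rw [hrange, Finset.sum_filter, Finset.mul_sum, Finset.mul_sum, ← Finset.sum_sub_distrib]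
  refine Finset.sum_congr rfl fun k hk => ?_
  have hk := Finset.mem_range.1 hk
  have e1 : (k : ℝ) * (1 / 2 * Real.pi / ((K + K : ℕ) : ℝ)) =
      k * Real.pi / (2 * ((K + K : ℕ) : ℝ)) := by push_cast; field_simp
  have e2 : (k : ℝ) * (1 / 4 * Real.pi / (K : ℝ)) =
      k * Real.pi / (2 * ((K + K : ℕ) : ℝ)) := by push_cast; field_simp; ring
  simp only [e1, e2, ite_sin_eq_expRate three_pos hM1, sepTheta, sepDelta, hdiv, hsqrt]
  rw [← mul_assoc, ← ite_zero_mul, ← mul_assoc (4 * ((r - 1) / r) ^ 2 / Real.pi), ← sub_mul]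
  congr 1
  rw [hrM]
  push_cast
  rcases Nat.lt_trichotomy k K with h | h | h
  · rcases Nat.eq_zero_or_pos k with h0 | h0
    · subst h0
      simp
      field_simp
      ring
    · rw [if_neg (by omega), if_pos (by omega), if_neg (by omega), if_neg (by omega), if_pos h]
      field_simp
      ring
  · subst h
    rw [if_neg (by omega), if_pos (by omega), if_pos (by omega), if_neg (by omega), if_neg (by omega),
      if_pos rfl]
    field_simp
    ring
  · rcases Nat.lt_or_ge k (K + K) with h0 | h0
    · rw [if_neg (by omega), if_neg (by omega), if_neg (by omega), if_neg (by omega),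
        if_neg (by omega), if_pos h0]
      field_simp
      ring
    · have : k = K + K := by omega
      subst this
      rw [if_pos (by omega), if_neg (by omega), if_neg (by omega), if_neg (by omega),
        if_neg (by omega), if_neg (by omega)]
      field_simp
      ring

lemma sepTrapezoid_eq_sum {S : Modulation} {N : ℕ} (hS : S.Admissible N) (γ : ℝ) :
    sepTrapezoid S N γ = ∑ k ∈ Finset.range (N + 1),
      sepTheta S N k * expRate (sepDelta S N k) γ := by
  cases S with
  | psk M => exact sepTrapezoid_psk hS.1 hS.2 γ
  | qam M => exact sepTrapezoid_qam hS.1 hS.2.1 hS.2.2 γ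
  | dpsk M => exact sepTrapezoid_dpsk hS.1 hS.2 γ
  | gcdqpsk => exact sepTrapezoid_gcdqpsk hS γ

/-- The identity between the Laplace transform and the bracket is available only for positive rates,
since the second argument of the H-function must be positive. -/
lemma sepDelta_ne_zero {S : Modulation} {N : ℕ} (hS : S.Admissible N) (k : ℕ) :
    sepDelta S N k ≠ 0 := by
  cases S with
  | psk M =>
    simp [sepDelta, ENNReal.div_eq_zero_iff, (sin_pi_div_pos hS.1).ne']
  | qam M => simp [sepDelta, ENNReal.div_eq_zero_iff]
  | dpsk M =>
    have hc := cos_pi_div_mem hS.1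
    have := div_pos (pow_pos (sin_pi_div_pos hS.1) 2)
      (one_add_mul_cos_pos (d := Real.cos (Real.pi / M)) (by rw [abs_of_nonneg hc.1]; exact hc.2)
        (k * (M - 1) * Real.pi / (N * M)))
    simpa [sepDelta] using this
  | gcdqpsk =>
    have h := one_add_mul_cos_pos abs_neg_inv_sqrt_two_lt (k * Real.pi / N)
    rw [neg_mul, ← sub_eq_add_neg] at h
    have := one_div_pos.2 h
    rw [sepDelta, ne_eq, ENNReal.ofReal_eq_zero, not_le]
    exact this

/-! ### The law of the SINR -/

lemma measurable_sinr (ω ϱ τ : ℝ) : Measurable (sinr ω ϱ τ) := by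
  unfold sinr; fun_prop

lemma sinr_pos {ω ϱ τ x : ℝ} (hω : 0 < ω) (hϱ : 0 < ϱ) (hτ : 0 < τ) (hx : 0 < x) :
    0 < sinr ω ϱ τ x := by
  unfold sinr; positivity

lemma exp_neg_mul_sinr {ω ϱ τ x : ℝ} (hϱ : 0 < ϱ) (hτ : 0 < τ) (hx : 0 < x) (δ : ℝ) :
    Real.exp (-(δ * sinr ω ϱ τ x)) = 1 - satExp (δ * ω / ϱ) (τ / ϱ) x := by
  rw [satExp, sub_sub_cancel, sinr]
  congr 2
  field_simp

/-- On the positive axis the SINR is a Möbius map with inverse y ↦ τy/(ω - ϱy). The inverse is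
differentiable below the pole ω/ϱ, and differentiable maps send null sets to null sets. -/
lemma volume_sinr_preimage_inter_Ioi {ω ϱ τ : ℝ} (hω : 0 < ω) (hϱ : 0 < ϱ) (hτ : 0 < τ) {A : Set ℝ}
    (hA : volume A = 0) : volume (sinr ω ϱ τ ⁻¹' A ∩ Ioi 0) = 0 := by
  have hsub : sinr ω ϱ τ ⁻¹' A ∩ Ioi 0 ⊆
      (fun y => τ * y / (ω - ϱ * y)) '' (A ∩ {y | ϱ * y < ω}) := by
    rintro x ⟨hxA, hx⟩
    have hx : 0 < x := hx
    have hy : sinr ω ϱ τ x = ω * x / (ϱ * x + τ) := by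
      unfold sinr; field_simp
    have hpos : 0 < ϱ * x + τ := by positivity
    have hsub : ω - ϱ * sinr ω ϱ τ x = ω * τ / (ϱ * x + τ) := by
      rw [hy]; field_simp; ring
    refine ⟨sinr ω ϱ τ x, ⟨hxA, ?_⟩, ?_⟩
    · have : 0 < ω - ϱ * sinr ω ϱ τ x := by rw [hsub]; positivity
      simpa using this
    · beta_reduce
      rw [hsub, hy]
      field_simp
  refine measure_mono_null hsub (addHaar_image_eq_zero_of_differentiableOn_of_addHaar_eq_zero volume
    (fun y hy => ?_) (measure_mono_null inter_subset_left hA))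
  have : ω - ϱ * y ≠ 0 := by
    have : ϱ * y < ω := hy.2
    linarith
  exact DifferentiableAt.differentiableWithinAt (by fun_prop (disch := exact this))

section sinr

variable {Ω : Type*} [MeasurableSpace Ω] {P : Measure Ω} {γid : Ω → ℝ}
  {f : ℝ → ℝ} {ω ϱ τ : ℝ}

lemma ae_pos_of_map_eq (hγid : AEMeasurable γid P) {g : ℝ → ℝ≥0∞}
    (hpdf : P.map γid = (volume.restrict (Ioi 0)).withDensity g) : ∀ᵐ w ∂P, 0 < γid w := by
  refine ae_of_ae_map hγid ?_
  rw [hpdf]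
  exact (withDensity_absolutelyContinuous _ _).ae_le (ae_restrict_mem measurableSet_Ioi)

lemma integral_comp_eq_integral_density (hγid : AEMeasurable γid P) (hf : Measurable f)
    (hf0 : ∀ x, 0 < x → 0 ≤ f x)
    (hpdf : P.map γid = (volume.restrict (Ioi 0)).withDensity fun x => ENNReal.ofReal (f x))
    {h : ℝ → ℝ} (hh : Measurable h) :
    ∫ w, h (γid w) ∂P = ∫ x in Ioi (0 : ℝ), f x * h x := by
  rw [← integral_map hγid hh.aestronglyMeasurable, hpdf,
    integral_withDensity_eq_integral_toReal_smul hf.ennreal_ofReal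
      (ae_of_all _ fun _ => ENNReal.ofReal_lt_top)]
  refine setIntegral_congr_fun measurableSet_Ioi fun x hx => ?_
  simp only [ENNReal.toReal_ofReal (hf0 x hx), smul_eq_mul]

variable [IsProbabilityMeasure P]

lemma hasPDF_sinr (hγid : AEMeasurable γid P) {g : ℝ → ℝ≥0∞}
    (hpdf : P.map γid = (volume.restrict (Ioi 0)).withDensity g) (hω : 0 < ω) (hϱ : 0 < ϱ)
    (hτ : 0 < τ) : HasPDF (fun w => sinr ω ϱ τ (γid w)) P volume := by
  rw [Real.hasPDF_iff]
  have hm := measurable_sinr ω ϱ τ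
  refine ⟨hm.comp_aemeasurable hγid, Measure.AbsolutelyContinuous.mk fun A hA h0 => ?_⟩
  rw [← Function.comp_def, ← AEMeasurable.map_map_of_aemeasurable hm.aemeasurable hγid,
    Measure.map_apply hm hA, hpdf]
  refine withDensity_absolutelyContinuous _ _ ?_
  rw [Measure.restrict_apply (hm hA)]
  exact volume_sinr_preimage_inter_Ioi hω hϱ hτ h0

/-- The law of the unconscious statistician for the positive random variable `sinr`. -/
lemma setIntegral_pdf_sinr_mul (hγid : AEMeasurable γid P) {g : ℝ → ℝ≥0∞}
    (hpdf : P.map γid = (volume.restrict (Ioi 0)).withDensity g) (hω : 0 < ω) (hϱ : 0 < ϱ)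
    (hτ : 0 < τ) {h : ℝ → ℝ} (hh : Measurable h) :
    ∫ γ in Ioi (0 : ℝ), (pdf (fun w => sinr ω ϱ τ (γid w)) P volume γ).toReal * h γ =
      ∫ w, h (sinr ω ϱ τ (γid w)) ∂P := by
  have := hasPDF_sinr hγid hpdf hω hϱ hτ
  -- Cutting `h` off outside the positive axis costs nothing, because the SINR is almost surely
  -- positive.
  have h1 := pdf.integral_pdf_smul (ℙ := P) (μ := volume) (X := fun w => sinr ω ϱ τ (γid w))
    (f := (Ioi (0 : ℝ)).indicator h) (hh.indicator measurableSet_Ioi).aestronglyMeasurable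
  rw [← integral_indicator measurableSet_Ioi]
  refine Eq.trans ?_ (h1.trans (integral_congr_ae ?_))
  · congr 1
    funext γ
    by_cases hγ : γ ∈ Ioi (0 : ℝ) <;> simp [hγ]
  · filter_upwards [ae_pos_of_map_eq hγid hpdf] with w hw
    exact indicator_of_mem (show sinr ω ϱ τ (γid w) ∈ Ioi 0 from sinr_pos hω hϱ hτ hw) h

lemma integrableOn_density (hγid : AEMeasurable γid P) (hf : Measurable f)
    (hf0 : ∀ x, 0 < x → 0 ≤ f x)
    (hpdf : P.map γid = (volume.restrict (Ioi 0)).withDensity fun x => ENNReal.ofReal (f x)) :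
    IntegrableOn f (Ioi 0) := by
  have := Measure.isProbabilityMeasure_map hγid
  refine ⟨hf.aestronglyMeasurable, ?_⟩
  rw [hasFiniteIntegral_iff_ofReal (by
    filter_upwards [ae_restrict_mem measurableSet_Ioi] with x hx using hf0 x hx)]
  have h1 : P.map γid univ = 1 := measure_univ
  rw [hpdf, withDensity_apply _ MeasurableSet.univ, Measure.restrict_univ] at h1
  rw [h1]
  exact ENNReal.one_lt_top

lemma integral_exp_neg_mul_sinr (hγid : AEMeasurable γid P) (hf : Measurable f)
    (hf0 : ∀ x, 0 < x → 0 ≤ f x)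
    (hpdf : P.map γid = (volume.restrict (Ioi 0)).withDensity fun x => ENNReal.ofReal (f x))
    (hω : 0 < ω) (hϱ : 0 < ϱ) (hτ : 0 < τ) {δ : ℝ} (hδ : 0 < δ) :
    ∫ w, Real.exp (-(δ * sinr ω ϱ τ (γid w))) ∂P =
      1 - ∫ x in Ioi (0 : ℝ), f x * satExp (δ * ω / ϱ) (τ / ϱ) x := by
  have hpos := ae_pos_of_map_eq hγid hpdf
  have hr : 0 < τ / ϱ := by positivity
  have hκ : 0 < δ * ω / ϱ := by positivity
  have hm := measurable_satExp (δ * ω / ϱ) (τ / ϱ)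
  have h1 : ∫ w, Real.exp (-(δ * sinr ω ϱ τ (γid w))) ∂P =
      ∫ w, (1 - satExp (δ * ω / ϱ) (τ / ϱ) (γid w)) ∂P := by
    refine integral_congr_ae ?_
    filter_upwards [hpos] with w hw using exp_neg_mul_sinr hϱ hτ hw δ
  have hint : Integrable (fun w => satExp (δ * ω / ϱ) (τ / ϱ) (γid w)) P := by
    refine (integrable_const (1 : ℝ)).mono' (hm.comp_aemeasurable hγid).aestronglyMeasurable ?_
    filter_upwards [hpos] with w hw
    rw [Real.norm_of_nonneg (satExp_nonneg hκ.le hr hw.le)]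
    exact satExp_le_one _ _ _
  rw [h1, integral_sub (integrable_const _) hint,
    integral_comp_eq_integral_density hγid hf hf0 hpdf hm]
  simp

lemma tendsto_integral_exp_neg_mul_sinr (hγid : AEMeasurable γid P) {g : ℝ → ℝ≥0∞}
    (hpdf : P.map γid = (volume.restrict (Ioi 0)).withDensity g) (hω : 0 < ω) (hϱ : 0 < ϱ)
    (hτ : 0 < τ) :
    Tendsto (fun δ : ℝ => ∫ w, Real.exp (-(δ * sinr ω ϱ τ (γid w))) ∂P) atTop (𝓝 0) := by
  have hpos := ae_pos_of_map_eq hγid hpdf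
  have hm := (measurable_sinr ω ϱ τ).comp_aemeasurable hγid
  have h := tendsto_integral_filter_of_dominated_convergence (μ := P) (l := atTop)
    (F := fun (δ : ℝ) w => Real.exp (-(δ * sinr ω ϱ τ (γid w)))) (f := fun _ => 0) (fun _ => 1)
    (Eventually.of_forall fun δ =>
      (Real.measurable_exp.comp_aemeasurable (hm.const_mul δ).neg).aestronglyMeasurable) ?_
    (integrable_const _) ?_
  · simpa using h
  · filter_upwards [eventually_ge_atTop (0 : ℝ)] with δ hδ
    filter_upwards [hpos] with w hw
    rw [Real.norm_of_nonneg (Real.exp_pos _).le, Real.exp_le_one_iff]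
    have := mul_nonneg hδ (sinr_pos hω hϱ hτ hw).le
    linarith
  · filter_upwards [hpos] with w hw
    refine Real.tendsto_exp_atBot.comp (tendsto_neg_atTop_atBot.comp ?_)
    exact tendsto_id.atTop_mul_const (sinr_pos hω hϱ hτ hw)

end sinr

/-! ### Assembling the average symbol error probability -/

lemma measurable_expRate (δ : ℝ≥0∞) : Measurable (expRate δ) := by
  unfold expRate
  split_ifs <;> fun_prop

lemma norm_expRate_le (δ : ℝ≥0∞) {γ : ℝ} (hγ : 0 ≤ γ) : ‖expRate δ γ‖ ≤ 1 := by
  unfold expRate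
  split_ifs
  · simp
  · rw [Real.norm_of_nonneg (Real.exp_pos _).le, Real.exp_le_one_iff]
    have := mul_nonneg (ENNReal.toReal_nonneg (a := δ)) hγ
    linarith

theorem proposition3
    -- the ideal SNR, a random variable whose density is a finite sum of Fox H-functions
    {Ω : Type*} [MeasurableSpace Ω] (P : Measure Ω) [IsProbabilityMeasure P]
    (γid : Ω → ℝ) (hγid : AEMeasurable γid P)
    {L m n p q : ℕ} (ψ φ : Fin L → ℝ) (F : Fin L → FoxParams m n p q) (c₀ : Fin L → ℝ)
    (hψ : ∀ l, 0 < ψ l) (hφ : ∀ l, 0 < φ l)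
    (hA : ∀ l i, 0 < (F l).A i) (hB : ∀ l i, 0 < (F l).B i)
    (hsep : ∀ l, (F l).Separates (c₀ l)) (hconv : ∀ l, (F l).Converges (c₀ l))
    (f : ℝ → ℝ) (hf0 : ∀ x, 0 < x → 0 ≤ f x)
    (hf : ∀ x, 0 < x → (f x : ℂ) = ∑ l, (ψ l : ℂ) * foxH (F l) (c₀ l) (φ l * x))
    (hpdf : P.map γid = (volume.restrict (Ioi 0)).withDensity fun x => ENNReal.ofReal (f x))
    -- the impairment parameters
    (ω ϱ τ : ℝ) (hω : 0 < ω) (hϱ : 0 < ϱ) (hτ : 0 < τ)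
    -- the contours of the bivariate Fox H-functions
    (c d : Fin L → ℝ)
    (hcd : ∀ l, foxH2Separates asepCross (F l).shift asepSecond (c l) (d l))
    -- the modulation scheme and the number of subintervals
    (S : Modulation) (N : ℕ) (hS : S.Admissible N) :
    -- the SINR has a density
    HasPDF (fun w => sinr ω ϱ τ (γid w)) P volume ∧
    -- the bivariate Mellin-Barnes integrals converge absolutely
    (∀ l, ∀ x y : ℝ, 0 < x → 0 < y →
      Integrable (foxH2Integrand asepCross (F l).shift asepSecond (c l) (d l) x y)) ∧
    -- the value of the bracket at an infinite rate is its limit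
    Tendsto (fun δ : ℝ => asepBracket ψ φ F c d ω ϱ τ δ) atTop (𝓝 0) ∧
    -- the average symbol error probability
    ((∫ γ in Ioi (0 : ℝ),
        (pdf (fun w => sinr ω ϱ τ (γid w)) P volume γ).toReal * sepTrapezoid S N γ : ℝ) : ℂ) =
      ∑ k ∈ Finset.range (N + 1),
        (sepTheta S N k : ℂ) * asepBracketExt ψ φ F c d ω ϱ τ (sepDelta S N k) := by
  have hsepc := fun l => foxH2Separates_asep (hcd l)
  have hint : ∀ l, ∀ x y : ℝ, 0 < x → 0 < y →
      Integrable (foxH2Integrand asepCross (F l).shift asepSecond (c l) (d l) x y) :=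
    fun l x y hx hy => integrable_foxH2Integrand_asep (hA l) (hB l) (hsep l) (hconv l) (hsepc l).1
      (hsepc l).2.1 (hsepc l).2.2.1 (hsepc l).2.2.2 hx hy
  -- The density f is not assumed measurable; the real part of the H-function sum is measurable on
  -- the whole line and agrees with f on the positive axis.
  set f' : ℝ → ℝ := fun x => (∑ l, (ψ l : ℂ) * foxH (F l) (c₀ l) (φ l * x)).re with hf'
  have hff' : ∀ x, 0 < x → f' x = f x := fun x hx => by
    simp only [hf', ← hf x hx, Complex.ofReal_re]
  have hf'm : Measurable f' := by
    refine Complex.measurable_re.comp (Finset.measurable_fun_sum _ fun l _ => ?_)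
    exact ((measurable_foxH (hsep l)).comp (measurable_const_mul _)).const_mul _
  have hf'0 : ∀ x, 0 < x → 0 ≤ f' x := fun x hx => (hff' x hx).symm ▸ hf0 x hx
  have hpdf' : P.map γid =
      (volume.restrict (Ioi 0)).withDensity fun x => ENNReal.ofReal (f' x) := by
    rw [hpdf]
    refine withDensity_congr_ae ?_
    filter_upwards [ae_restrict_mem measurableSet_Ioi] with x hx
    rw [hff' x hx]
  have hbracket : ∀ δ : ℝ, 0 < δ →
      ((∫ w, Real.exp (-(δ * sinr ω ϱ τ (γid w))) ∂P : ℝ) : ℂ) =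
        asepBracket ψ φ F c d ω ϱ τ δ := fun δ hδ => by
    rw [integral_exp_neg_mul_sinr hγid hf'm hf'0 hpdf' hω hϱ hτ hδ, Complex.ofReal_sub,
      Complex.ofReal_one, integral_foxH_sum_mul_satExp ψ φ F c₀ hφ hA hB hsep hconv hf'm
        (integrableOn_density hγid hf'm hf'0 hpdf') (fun x hx => by rw [hff' x hx, hf x hx])
        (fun l => (hsepc l).1) (fun l => (hsepc l).2.1) (fun l => (hsepc l).2.2.1)
        (fun l => (hsepc l).2.2.2) (by positivity) (by positivity), asepBracket]
    simp only [mul_div_assoc]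
  refine ⟨hasPDF_sinr hγid hpdf hω hϱ hτ, hint, ?_, ?_⟩
  -- The limit of the bracket is read off from the Laplace transform of a positive random variable;
  -- no contour estimate is involved.
  · have h := (Complex.continuous_ofReal.tendsto 0).comp
      (tendsto_integral_exp_neg_mul_sinr hγid hpdf hω hϱ hτ)
    rw [Complex.ofReal_zero] at h
    refine h.congr' ?_
    filter_upwards [eventually_gt_atTop (0 : ℝ)] with δ hδ using hbracket δ hδ
  · have hpos := ae_pos_of_map_eq hγid hpdf
    have hE : ∀ δ : ℝ≥0∞, δ ≠ 0 → ((∫ w, expRate δ (sinr ω ϱ τ (γid w)) ∂P : ℝ) : ℂ) =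
        asepBracketExt ψ φ F c d ω ϱ τ δ := fun δ hδ => by
      unfold expRate asepBracketExt
      split_ifs with h
      · simp
      · exact hbracket _ (ENNReal.toReal_pos hδ h)
    have hEint : ∀ δ : ℝ≥0∞, Integrable (fun w => expRate δ (sinr ω ϱ τ (γid w))) P := fun δ => by
      refine (integrable_const (1 : ℝ)).mono' ((measurable_expRate δ).comp_aemeasurable
        ((measurable_sinr ω ϱ τ).comp_aemeasurable hγid)).aestronglyMeasurable ?_
      filter_upwards [hpos] with w hw using norm_expRate_le δ (sinr_pos hω hϱ hτ hw).le
    simp only [sepTrapezoid_eq_sum hS]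
    rw [setIntegral_pdf_sinr_mul hγid hpdf hω hϱ hτ
      (Finset.measurable_fun_sum _ fun k _ => (measurable_expRate _).const_mul _),
      integral_finsetSum _ fun k _ => (hEint _).const_mul _, Complex.ofReal_sum]
    refine Finset.sum_congr rfl fun k _ => ?_
    rw [integral_const_mul, Complex.ofReal_mul, hE _ (sepDelta_ne_zero hS k)]
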